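/- Let $v_1,v_2,v_3,v_4,\mu,\nu\in\mathbb C$ with $v_3=v_4$, $v_1-v_3=-\nu$, $v_1-v_2=\mu$, and assume that none of $\mu+1$, $\nu+1$, $\mu+\nu+1$ is in $\{0,-1,-2,\dots\}$. Write ${}_1F_1(a,c;z)=\sum_{p\ge0}\frac{(a)_p}{(c)_p}\frac{z^p}{p!}$. (i) The function $y(t)={}_1F_1(v_1-v_3,\,v_1-v_2+1;\,-t)$ is analytic at the origin with $y(0)=1$ and satisfies $$t\,y''+(v_1-v_2+1+t)\,y'+(v_1-v_3)\,y=0 ,$$ and every solution $f$ of this equation near $0$ that is analytic at $0$ equals $f(0)\,y$ near $0$. (ii) Choose $\tau_1^{V^*}$ by $e^{-(v_1-v_3)t}\tau_1^{V^*}(t)=y(t)$, that is $\tau_1^{V^*}(t)=e^{-\nu t}{}_1F_1(-\nu,\mu+1;-t)$. On an open set $U\subset\mathbb C\setminus\{0\}$ that carries a holomorphic branch of $\log t$ (used for the powers of $t$), let the sequence $\tau_n^{V^*}$, $n=0,1,2,\dots$, be defined by $$\bar\tau_n=t^{n^2/2}e^{(v_4-v_1+n)t}\,\tau_n^{V^*},\qquad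 \bar\tau_n=\det\big[\delta^{j+k}\bar\tau_1\big]_{j,k=0,\dots,n-1},\qquad \delta=t\frac{d}{dt}.$$ Then for all $n\ge 0$ and $t\in U$, $$e^{\nu t}\tau_n^{V^*}(t)=\Big(\frac{\Gamma(\mu+1)}{\Gamma(\mu+\nu+1)}\Big)^n\Big(\prod_{l=0}^{n-1}\Gamma(\nu+l+1)\Big)\,\tau^V[n](t;\mu,\nu),$$ where $$\tau^V[n](t;\mu,\nu)=\det\Big[\frac{\Gamma(\mu+\nu+1)}{\Gamma(\mu+j-k+1)\,\Gamma(\nu-j+k+1)}\,{}_1F_1(-\nu+j-k,\mu+1+j-k;-t)\Big]_{j,k=1,\dots,n}$$ (with $1/\Gamma$ read as an entire function and ${}_1F_1(a,c;z)/\Gamma(c)$ as the entire function $\sum_{p\ge 0} (a)_p z^p/(\Gamma(c+p)\,p!)$). If $\mathrm{Re}(\mu+\nu)>-1$, the same identity holds with $\tau^V[n](t;\mu,\nu)$ given by the average over the unitary group $$\tau^V[n](t;\mu,\nu)=\Big\langle\prod_{l=1}^n z_l^{(\mu-\nu)/2}|1+z_l|^{\mu+\nu}e^{tz_l}\Big\rangle_{U(n)}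 =\frac1{(2\pi)^n n!}\int_{(-\pi,\pi]^n}\prod_{l=1}^n z_l^{(\mu-\nu)/2}|1+z_l|^{\mu+\nu}e^{tz_l}\prod_{1\le j<k\le n}|z_k-z_j|^2\,d\theta_1\cdots d\theta_n,$$ with $z_l=e^{i\theta_l}$ and $z_l^{s}=e^{is\theta_l}$. -/

import Mathlib

noncomputable section

namespace PainleveV

/-- Kummer's confluent hypergeometric function `₁F₁(a, c; z) = ∑ₚ (a)ₚ / (c)ₚ · zᵖ / p!`
(meaningful for `c ∉ {0, -1, -2, …}`). -/
def oneF1 (a c z : ℂ) : ℂ :=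
  ∑' p : ℕ, (ascPochhammer ℂ p).eval a / (ascPochhammer ℂ p).eval c * z ^ p / (p.factorial : ℂ)

/-- The regularised function `₁F₁(a, c; z) / Γ(c) = ∑ₚ (a)ₚ / Γ(c + p) · zᵖ / p!`, entire in all
three variables. (`Complex.Gamma` takes the value `0` at its poles, so that `x / Γ(s)` is `0` there,
the value of the entire function `1 / Γ`.) -/
def oneF1Reg (a c z : ℂ) : ℂ := Complex.regularizedHGFun {a} {c} z

theorem oneF1Reg_eq_tsum (a c z : ℂ) :
    oneF1Reg a c z =
      ∑' p : ℕ, (ascPochhammer ℂ p).eval a / Complex.Gamma (c + p) * z ^ p / (p.factorial : ℂ) := by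
  rw [oneF1Reg, Complex.regularizedHGFun, FormalMultilinearSeries.sum]
  refine tsum_congr fun p => ?_
  simp [Complex.regularizedHGFunSeries, Complex.regularizedHGFunCoeff, div_eq_mul_inv]
  ring

theorem gamma_add_nat (c : ℂ) (hc : ∀ m : ℕ, c ≠ -(m : ℂ)) (p : ℕ) :
    Complex.Gamma (c + p) = (ascPochhammer ℂ p).eval c * Complex.Gamma c := by
  induction p with
  | zero => simp
  | succ p ih =>
    have h : c + p ≠ 0 := fun h => hc p (eq_neg_of_add_eq_zero_left h)
    rw [Nat.cast_succ, ← add_assoc, Complex.Gamma_add_one _ h, ih, ascPochhammer_succ_eval]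
    ring

theorem oneF1Reg_eq (a c z : ℂ) (hc : ∀ m : ℕ, c ≠ -(m : ℂ)) :
    oneF1Reg a c z = oneF1 a c z / Complex.Gamma c := by
  rw [oneF1Reg_eq_tsum, oneF1, ← tsum_div_const]
  refine tsum_congr fun p => ?_
  rw [gamma_add_nat c hc p]
  simp only [div_eq_mul_inv, mul_inv]
  ring

/-- The average over the unitary group `U(n)`, in terms of eigenvalues `z_l = e^{iθ_l}`,
`⟨∏ z_l^{(μ-ν)/2} |1 + z_l|^{μ+ν} e^{t z_l}⟩`, with `-π < θ_l ≤ π` and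
`z^s = e^{isθ}`; the eigenvalue density is `(2π)^{-n} / n! · ∏_{j<k} |z_k - z_j|²`.
It is meaningful for `Re (μ + ν) > -1`. -/
def tauVAverage (n : ℕ) (t μ ν : ℂ) : ℂ :=
  1 / ((2 * (Real.pi : ℂ)) ^ n * (n.factorial : ℂ)) *
    ∫ θ : Fin n → ℝ in Set.univ.pi fun _ => Set.Ioc (-Real.pi) Real.pi,
      (∏ l, (Complex.exp (Complex.I * θ l * ((μ - ν) / 2)) *
          ((‖1 + Complex.exp (Complex.I * θ l)‖ : ℝ) : ℂ) ^ (μ + ν) *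
          Complex.exp (t * Complex.exp (Complex.I * θ l)))) *
        ((∏ j, ∏ k ∈ Finset.Ioi j,
          ‖Complex.exp (Complex.I * θ k) - Complex.exp (Complex.I * θ j)‖ ^ 2 : ℝ) : ℂ)

/-- `τ^V[n](t; μ, ν)` for general complex parameters: the Toeplitz determinant of the entries
`Γ(μ+ν+1) / (Γ(μ+j-k+1) Γ(ν-j+k+1)) · ₁F₁(-ν+j-k, μ+1+j-k; -t)`, where
`₁F₁(·, c; ·) / Γ(c)` is read as the regularised function. -/
def tauV (n : ℕ) (t μ ν : ℂ) : ℂ :=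
  (Matrix.of fun j k : Fin n =>
    Complex.Gamma (μ + ν + 1) / Complex.Gamma (ν - (j : ℂ) + (k : ℂ) + 1) *
      oneF1Reg (-ν + (j : ℂ) - (k : ℂ)) (μ + 1 + (j : ℂ) - (k : ℂ)) (-t)).det

/-- The operator `δ = t d/dt`. -/
def delta (f : ℂ → ℂ) : ℂ → ℂ := fun t => t * deriv f t

/-- The factor `t^{n²/2} e^{(v₄ - v₁ + n) t}` between `τ_n` and `τ̄_n`, where
`t^{n²/2} = e^{(n²/2) L(t)}` for the branch `L` of the logarithm. -/
def barFactor (L : ℂ → ℂ) (v₁ v₄ : ℂ) (n : ℕ) (t : ℂ) : ℂ :=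
  Complex.exp ((n : ℂ) ^ 2 / 2 * L t) * Complex.exp ((v₄ - v₁ + n) * t)

/-- `τ̄_n = det [δ^{j+k} τ̄_1]_{j,k=0,…,n-1}`, where `τ̄_1` is obtained from `τ_1`. -/
def barTau (L : ℂ → ℂ) (v₁ v₄ : ℂ) (τ₁ : ℂ → ℂ) (n : ℕ) (t : ℂ) : ℂ :=
  (Matrix.of fun j k : Fin n =>
    (delta^[(j : ℕ) + (k : ℕ)] (fun s => barFactor L v₁ v₄ 1 s * τ₁ s)) t).det

/-- The sequence `τ_n^{V*}` generated by `τ_1^{V*}`: it is given by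
`τ̄_n = t^{n²/2} e^{(v₄ - v₁ + n) t} τ_n^{V*}` and `τ̄_n = det [δ^{j+k} τ̄_1]`. -/
def tauVStar (L : ℂ → ℂ) (v₁ v₄ : ℂ) (τ₁ : ℂ → ℂ) (n : ℕ) (t : ℂ) : ℂ :=
  barTau L v₁ v₄ τ₁ n t / barFactor L v₁ v₄ n t

theorem barFactor_ne_zero (L : ℂ → ℂ) (v₁ v₄ : ℂ) (n : ℕ) (t : ℂ) :
    barFactor L v₁ v₄ n t ≠ 0 :=
  mul_ne_zero (Complex.exp_ne_zero _) (Complex.exp_ne_zero _)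

theorem tauVStar_zero (L : ℂ → ℂ) (v₁ v₄ : ℂ) (τ₁ : ℂ → ℂ) (t : ℂ) :
    tauVStar L v₁ v₄ τ₁ 0 t = Complex.exp ((v₁ - v₄) * t) := by
  simp only [tauVStar, barTau, barFactor, Matrix.det_fin_zero]
  rw [one_div, ← Complex.exp_add, ← Complex.exp_neg]
  congr 1
  push_cast
  ring

theorem tauVStar_one (L : ℂ → ℂ) (v₁ v₄ : ℂ) (τ₁ : ℂ → ℂ) (t : ℂ) :
    tauVStar L v₁ v₄ τ₁ 1 t = τ₁ t := by
  simp [tauVStar, barTau, barFactor_ne_zero]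

/-- `f` satisfies the confluent hypergeometric equation
`t f'' + (v₁ - v₂ + 1 + t) f' + (v₁ - v₃) f = 0` at the point `t`. -/
def SatisfiesODE (v₁ v₂ v₃ : ℂ) (f : ℂ → ℂ) (t : ℂ) : Prop :=
  t * deriv (deriv f) t + (v₁ - v₂ + 1 + t) * deriv f t + (v₁ - v₃) * f t = 0

end PainleveV

end

/-! Everything is expressed through one entire function, K(μ,ν;t) = ∑ tᵖ / (Γ(μ+p+1) Γ(ν-p+1) p!), a
constant multiple of y. Differentiation is the shift (μ,ν) → (μ+1,ν-1), and a contiguous relation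
goes back down. Kummer's equation combines the two; uniqueness holds because a difference vanishing
at 0 to order M+1 would need (M+1)(μ+1+M) = 0.

Put w_m = t^{1/2} eᵗ K(μ+m,ν-m). Then δ w_m = (1/2+t) w_m + t w_{m+1}, while (ν+k+1) w_{-k-1} = δ
w_{-k} + (μ-k-1/2) w_{-k} with constant coefficients. The determinant of δʲ w_{-k} is evaluated
twice. Lowering, as column operations, gives the Hankel determinant of δ^{j+k} w_0 and the factors
ν+i+1 (`prod_mul_det_eq_hankel`). Raising, as row operations with diagonal tʲ, gives the Toeplitz
determinant of w_{j-k} (`exists_iterate_delta_expansion`). Equating them is `hankel_raisedKernel`.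

For the unitary average, Andréief's formula gives a Toeplitz determinant of Fourier coefficients.
Expanding e^{tz} reduces each entry to Cauchy's beta integral (`circleIntegralWeight_eq`), obtained
from a recurrence in (μ,ν), Laplace's method and Euler's limit for Γ. -/

noncomputable section
namespace PainleveV
open Complex Filter Topology

/-! ### The kernel: shift, contiguous relation, Kummer's equation -/

/-- The entire function `∑ₚ tᵖ / (Γ(μ + p + 1) Γ(ν - p + 1) p!)`, which equals
`₁F₁(-ν, μ + 1; -t) / (Γ(μ + 1) Γ(ν + 1))`. -/
def kummerKernel (μ ν t : ℂ) : ℂ :=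
  ∑' p : ℕ, (Gamma (μ + p + 1))⁻¹ * (Gamma (ν - p + 1))⁻¹ * (t ^ p / (p.factorial : ℂ))

theorem inv_Gamma_eq_mul (s : ℂ) : (Gamma s)⁻¹ = s * (Gamma (s + 1))⁻¹ :=
  one_div_Gamma_eq_self_mul_one_div_Gamma_add_one s

/-- Absorbing the Pochhammer symbol into 1/Γ makes μ and ν enter symmetrically, as needed for the
shifts. No exclusion on ν arises, since 1/Γ(s) = s/Γ(s+1) also holds at the poles with value 0. -/
theorem ascPochhammer_mul_inv_Gamma (ν : ℂ) (p : ℕ) :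
    (ascPochhammer ℂ p).eval (-ν) * (-1) ^ p * (Gamma (ν + 1))⁻¹ = (Gamma (ν - p + 1))⁻¹ := by
  induction p with
  | zero => simp
  | succ p ih =>
    rw [inv_Gamma_eq_mul (ν - (p + 1 : ℕ) + 1), ascPochhammer_succ_eval, pow_succ]
    have : ν - (p + 1 : ℕ) + 1 + 1 = ν - p + 1 := by push_cast; ring
    rw [this, ← ih]
    push_cast
    ring

theorem summable_norm_oneF1Reg (a c z : ℂ) :
    Summable fun p : ℕ =>
      ‖(ascPochhammer ℂ p).eval a / Gamma (c + p) * z ^ p / (p.factorial : ℂ)‖ := by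
  have h := (regularizedHGFunSeries {a} {c}).summable_norm_mul_pow (r := ‖z‖₊)
    (by rw [radius_regularizedHGFunSeries_eq_top (by simp)]; exact ENNReal.coe_lt_top)
  refine h.congr fun p => ?_
  rw [FormalMultilinearSeries.norm_apply_eq_norm_coef, regularizedHGFunSeries_coeff]
  simp [regularizedHGFunCoeff]
  ring

theorem kummerKernel_term_eq (μ ν t : ℂ) (p : ℕ) :
    (Gamma (μ + p + 1))⁻¹ * (Gamma (ν - p + 1))⁻¹ * (t ^ p / (p.factorial : ℂ)) =
      (ascPochhammer ℂ p).eval (-ν) / Gamma (μ + 1 + p) * (-t) ^ p / (p.factorial : ℂ) *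
        (Gamma (ν + 1))⁻¹ := by
  rw [← ascPochhammer_mul_inv_Gamma, neg_pow t, add_right_comm μ]
  ring

theorem summable_norm_kummerKernel (μ ν t : ℂ) :
    Summable fun p : ℕ =>
      ‖(Gamma (μ + p + 1))⁻¹ * (Gamma (ν - p + 1))⁻¹ * (t ^ p / (p.factorial : ℂ))‖ := by
  simp_rw [kummerKernel_term_eq, norm_mul _ (Gamma (ν + 1))⁻¹]
  exact (summable_norm_oneF1Reg _ _ _).mul_right _

theorem hasSum_kummerKernel (μ ν t : ℂ) :
    HasSum (fun p : ℕ =>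
      (Gamma (μ + p + 1))⁻¹ * (Gamma (ν - p + 1))⁻¹ * (t ^ p / (p.factorial : ℂ)))
      (kummerKernel μ ν t) :=
  (summable_norm_kummerKernel μ ν t).of_norm.hasSum

theorem kummerKernel_eq_oneF1Reg (μ ν t : ℂ) :
    kummerKernel μ ν t = oneF1Reg (-ν) (μ + 1) (-t) / Gamma (ν + 1) := by
  simp_rw [kummerKernel, kummerKernel_term_eq, tsum_mul_right, oneF1Reg_eq_tsum, div_eq_mul_inv]

/-- Weierstrass M-test on the ball of radius ‖t‖+1: the terms there are dominated by those at the
real point ‖t‖+1. -/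
theorem differentiable_kummerKernel_aux (μ ν t : ℂ) :
    DifferentiableAt ℂ (kummerKernel μ ν) t ∧
      HasSum (fun p : ℕ => (Gamma (μ + p + 1))⁻¹ * (Gamma (ν - p + 1))⁻¹ *
        (p * t ^ (p - 1) / (p.factorial : ℂ))) (deriv (kummerKernel μ ν) t) := by
  have ht : t ∈ Metric.ball (0 : ℂ) (‖t‖ + 1) := by simp
  have hd : ∀ p : ℕ, ∀ w : ℂ, HasDerivAt (fun w : ℂ =>
      (Gamma (μ + p + 1))⁻¹ * (Gamma (ν - p + 1))⁻¹ * (w ^ p / (p.factorial : ℂ)))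
      ((Gamma (μ + p + 1))⁻¹ * (Gamma (ν - p + 1))⁻¹ *
        (p * w ^ (p - 1) / (p.factorial : ℂ))) w := fun p w =>
    ((hasDerivAt_pow p w).div_const _).const_mul _
  have hle : ∀ (p : ℕ) (w : ℂ), w ∈ Metric.ball (0 : ℂ) (‖t‖ + 1) →
      ‖(Gamma (μ + p + 1))⁻¹ * (Gamma (ν - p + 1))⁻¹ * (w ^ p / (p.factorial : ℂ))‖ ≤
      ‖(Gamma (μ + p + 1))⁻¹ * (Gamma (ν - p + 1))⁻¹ *
        (((‖t‖ + 1 : ℝ) : ℂ) ^ p / (p.factorial : ℂ))‖ := by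
    intro p w hw
    have h1 : ‖((‖t‖ + 1 : ℝ) : ℂ)‖ = ‖t‖ + 1 := by
      rw [norm_real, Real.norm_of_nonneg (by positivity)]
    rw [norm_mul, norm_mul _ (_ / _), norm_div, norm_div, norm_pow, norm_pow, h1]
    gcongr
    exact (mem_ball_zero_iff.mp hw).le
  have hs := summable_norm_kummerKernel μ ν ((‖t‖ + 1 : ℝ) : ℂ)
  have hdo : ∀ p : ℕ, DifferentiableOn ℂ (fun w : ℂ =>
      (Gamma (μ + p + 1))⁻¹ * (Gamma (ν - p + 1))⁻¹ * (w ^ p / (p.factorial : ℂ)))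
      (Metric.ball 0 (‖t‖ + 1)) := fun p w _ => (hd p w).differentiableAt.differentiableWithinAt
  refine ⟨(differentiableOn_tsum_of_summable_norm hs hdo Metric.isOpen_ball hle).differentiableAt
    (Metric.isOpen_ball.mem_nhds ht), ?_⟩
  have := hasSum_deriv_of_summable_norm hs hdo Metric.isOpen_ball hle ht
  simp_rw [fun p => (hd p t).deriv] at this
  exact this

theorem deriv_kummerKernel (μ ν t : ℂ) :
    deriv (kummerKernel μ ν) t = kummerKernel (μ + 1) (ν - 1) t := by
  refine (differentiable_kummerKernel_aux μ ν t).2.unique ?_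
  rw [← hasSum_nat_add_iff' 1]
  simp only [Finset.range_one, Finset.sum_singleton, Nat.cast_zero, zero_mul, zero_div, mul_zero,
    sub_zero]
  refine (hasSum_kummerKernel (μ + 1) (ν - 1) t).congr_fun ?_
  intro p
  have h : ((p + 1 : ℕ) : ℂ) ≠ 0 := by exact_mod_cast p.succ_ne_zero
  rw [Nat.factorial_succ, Nat.cast_mul, Nat.add_sub_cancel, mul_div_mul_left _ _ h]
  push_cast
  ring_nf

theorem hasDerivAt_kummerKernel (μ ν t : ℂ) :
    HasDerivAt (kummerKernel μ ν) (kummerKernel (μ + 1) (ν - 1) t) t := by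
  rw [← deriv_kummerKernel]
  exact (differentiable_kummerKernel_aux μ ν t).1.hasDerivAt

/-- Compare coefficients of tᵖ/p!: after 1/Γ(s) = s/Γ(s+1), every term is a multiple of 1/(Γ(μ+p+1)
Γ(ν-p+2)), and the identity is ν+1 = (ν-p+1) + p times μ+p. -/
theorem kummerKernel_contiguous (μ ν t : ℂ) :
    (ν + 1) * kummerKernel (μ - 1) (ν + 1) t =
      (μ + t) * kummerKernel μ ν t + t * kummerKernel (μ + 1) (ν - 1) t := by
  have h1 := (hasSum_kummerKernel (μ - 1) (ν + 1) t).mul_left (ν + 1)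
  have h2 := (hasSum_kummerKernel μ ν t).mul_left μ
  have h3 := (differentiable_kummerKernel_aux μ ν t).2.mul_left t
  -- Multiplication by t shifts the index by one; the factor p kills the new term at p = 0.
  have h4 : HasSum (fun p : ℕ => (Gamma (μ + p))⁻¹ * (Gamma (ν - p + 2))⁻¹ *
      (p * t ^ p / (p.factorial : ℂ))) (t * kummerKernel μ ν t) := by
    rw [← hasSum_nat_add_iff' 1]
    simp only [Finset.range_one, Finset.sum_singleton, Nat.cast_zero, zero_mul, zero_div, mul_zero,
      sub_zero]
    refine ((hasSum_kummerKernel μ ν t).mul_left t).congr_fun ?_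
    intro p
    have h : ((p + 1 : ℕ) : ℂ) ≠ 0 := by exact_mod_cast p.succ_ne_zero
    rw [Nat.factorial_succ, Nat.cast_mul, mul_div_mul_left _ _ h]
    push_cast
    ring_nf
  rw [deriv_kummerKernel] at h3
  rw [add_mul μ t]
  refine h1.unique (((h2.add h4).add h3).congr_fun fun p => ?_)
  have e1 : μ - 1 + p + 1 = μ + p := by ring
  have e2 : ν + 1 - p + 1 = ν - p + 2 := by ring
  have e3 := inv_Gamma_eq_mul (ν - p + 1)
  have e4 := inv_Gamma_eq_mul (μ + p)
  have e5 : ν - p + 1 + 1 = ν - p + 2 := by ring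
  rw [e5] at e3
  have e6 : t * ((Gamma (μ + p + 1))⁻¹ * (Gamma (ν - p + 1))⁻¹ *
      (p * t ^ (p - 1) / (p.factorial : ℂ))) = (Gamma (μ + p + 1))⁻¹ * (Gamma (ν - p + 1))⁻¹ *
      (p * t ^ p / (p.factorial : ℂ)) := by
    rcases p with _ | p
    · simp
    · rw [Nat.add_sub_cancel, pow_succ]; ring
  rw [e6, e1, e2, e3, e4]
  ring

theorem analyticAt_kummerKernel (μ ν t : ℂ) : AnalyticAt ℂ (kummerKernel μ ν) t :=
  Differentiable.analyticAt (fun s => (differentiable_kummerKernel_aux μ ν s).1) t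

theorem kummerKernel_zero (μ ν : ℂ) :
    kummerKernel μ ν 0 = (Gamma (μ + 1))⁻¹ * (Gamma (ν + 1))⁻¹ := by
  rw [kummerKernel, tsum_eq_single 0 fun p hp => by simp [hp]]
  simp

theorem oneF1_eq_kummerKernel {μ ν : ℂ} (hμ : ∀ m : ℕ, μ + 1 ≠ -(m : ℂ))
    (hν : ∀ m : ℕ, ν + 1 ≠ -(m : ℂ)) (t : ℂ) :
    oneF1 (-ν) (μ + 1) (-t) = Gamma (μ + 1) * Gamma (ν + 1) * kummerKernel μ ν t := by
  have h1 := Gamma_ne_zero hμ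
  have h2 := Gamma_ne_zero hν
  rw [kummerKernel_eq_oneF1Reg, oneF1Reg_eq _ _ _ hμ]
  field_simp

/-- Both derivatives are shifts of the kernel, so this is the contiguous relation at (μ+1, ν-1). -/
theorem kummerKernel_ode (μ ν t : ℂ) :
    t * deriv (deriv (kummerKernel μ ν)) t + (μ + 1 + t) * deriv (kummerKernel μ ν) t -
      ν * kummerKernel μ ν t = 0 := by
  have h : deriv (kummerKernel μ ν) = kummerKernel (μ + 1) (ν - 1) :=
    funext fun s => deriv_kummerKernel μ ν s
  have h2 := kummerKernel_contiguous (μ + 1) (ν - 1) t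
  rw [h, deriv_kummerKernel]
  simp only [add_sub_cancel_right, sub_add_cancel] at h2
  rw [h2]
  ring

/-! ### Uniqueness of the analytic solution -/

/-- An analytic solution near `0` of `t g'' + (μ + 1 + t) g' - ν g = 0` with `g 0 = 0` vanishes
near `0`, provided `μ + 1` is not a non-positive integer. -/
theorem eventually_eq_zero_of_kummer_ode {μ ν : ℂ} (hμ : ∀ m : ℕ, μ + 1 ≠ -(m : ℂ)) {g : ℂ → ℂ}
    (hg : AnalyticAt ℂ g 0) (hg0 : g 0 = 0)
    (hode : ∀ᶠ t in 𝓝 (0 : ℂ),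
      t * deriv (deriv g) t + (μ + 1 + t) * deriv g t - ν * g t = 0) :
    ∀ᶠ t in 𝓝 (0 : ℂ), g t = 0 := by
  by_contra hne
  obtain ⟨N, h, hh, hh0, hgh⟩ := hg.exists_eventuallyEq_pow_smul_nonzero_iff.mpr hne
  simp only [sub_zero, smul_eq_mul] at hgh
  rcases N with _ | M
  · have := hgh.self_of_nhds
    simp only [pow_zero, one_mul, hg0] at this
    exact hh0 this.symm
  have hd1 : ∀ᶠ t in 𝓝 (0 : ℂ), HasDerivAt g ((M + 1) * t ^ M * h t + t ^ (M + 1) * deriv h t) t := by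
    filter_upwards [hgh.eventually_nhds, hh.eventually_analyticAt] with t h1 h2
    have := (hasDerivAt_pow (M + 1) t).mul h2.differentiableAt.hasDerivAt
    simpa using this.congr_of_eventuallyEq h1
  have hd2 : ∀ᶠ t in 𝓝 (0 : ℂ), deriv (deriv g) t =
      (M + 1) * (M * t ^ (M - 1)) * h t + 2 * ((M + 1) * t ^ M * deriv h t) +
        t ^ (M + 1) * deriv (deriv h) t := by
    have hd1' : ∀ᶠ t in 𝓝 (0 : ℂ), deriv g t =
        (M + 1) * t ^ M * h t + t ^ (M + 1) * deriv h t := hd1.mono fun t ht => ht.deriv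
    filter_upwards [hd1'.eventually_nhds, hh.eventually_analyticAt] with t h1 h2
    have e1 := ((hasDerivAt_pow M t).const_mul ((M : ℂ) + 1)).mul h2.differentiableAt.hasDerivAt
    have e2 := (hasDerivAt_pow (M + 1) t).mul h2.deriv.differentiableAt.hasDerivAt
    rw [((e1.add e2).congr_of_eventuallyEq h1).deriv]
    simp only [Nat.cast_add, Nat.cast_one, Nat.add_sub_cancel]
    ring
  -- With g = t^(M+1) h and h(0) ≠ 0, this is the equation divided by t^M. Its value at 0 is the
  -- indicial expression (M+1)(μ+1+M) h(0).
  let b : ℂ → ℂ := fun t => (M + 1) * M * h t + 2 * ((M + 1) * t * deriv h t) +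
    t ^ 2 * deriv (deriv h) t + (μ + 1 + t) * ((M + 1) * h t + t * deriv h t) - ν * (t * h t)
  have hb : ∀ᶠ t in 𝓝[≠] (0 : ℂ), b t = 0 := by
    have := ((hode.and hgh).and (hd1.and hd2)).filter_mono (nhdsWithin_le_nhds (s := {0}ᶜ))
    filter_upwards [this, self_mem_nhdsWithin] with t ht ht0
    obtain ⟨⟨h1, h2⟩, h3, h4⟩ := ht
    have ht0' : t ≠ 0 := ht0
    rw [h4, h3.deriv, h2] at h1
    -- The truncated exponent M - 1 is harmless at M = 0 because of the factor M.
    have hM : (M : ℂ) * t ^ (M - 1) * t = M * t ^ M := by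
      rcases M with _ | M
      · simp
      · rw [Nat.add_sub_cancel, pow_succ]; ring
    have : t ^ M * b t = 0 := by
      rw [← h1]
      linear_combination (-(M + 1) * h t) * hM
    exact (mul_eq_zero.mp this).resolve_left (pow_ne_zero _ ht0')
  have hbc : ContinuousAt b 0 := by
    have := hh.continuousAt
    have := hh.deriv.continuousAt
    have := hh.deriv.deriv.continuousAt
    fun_prop
  have hb0 : b 0 = 0 := by
    refine tendsto_nhds_unique (l := 𝓝[≠] (0 : ℂ))
      (hbc.tendsto.mono_left nhdsWithin_le_nhds) ?_
    exact tendsto_const_nhds.congr' (hb.mono fun t ht => ht.symm)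
  have : (M + 1 : ℂ) * h 0 * (μ + 1 + M) = 0 := by
    refine Eq.trans ?_ hb0; simp only [b]; ring
  rcases mul_eq_zero.mp this with h | h
  · exact (mul_ne_zero (by exact_mod_cast M.succ_ne_zero) hh0) h
  · exact hμ M (eq_neg_of_add_eq_zero_left h)

theorem kummer_ode_unique {μ ν : ℂ} (hμ : ∀ m : ℕ, μ + 1 ≠ -(m : ℂ)) {y f : ℂ → ℂ}
    (hy : AnalyticAt ℂ y 0) (hy0 : y 0 = 1) (hf : AnalyticAt ℂ f 0)
    (hyode : ∀ᶠ t in 𝓝 (0 : ℂ),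
      t * deriv (deriv y) t + (μ + 1 + t) * deriv y t - ν * y t = 0)
    (hfode : ∀ᶠ t in 𝓝 (0 : ℂ),
      t * deriv (deriv f) t + (μ + 1 + t) * deriv f t - ν * f t = 0) :
    ∀ᶠ t in 𝓝 (0 : ℂ), f t = f 0 * y t := by
  have hg : AnalyticAt ℂ (fun t => f t - f 0 * y t) 0 := hf.sub (analyticAt_const.mul hy)
  have hd : ∀ᶠ t in 𝓝 (0 : ℂ), deriv (fun t => f t - f 0 * y t) t = deriv f t - f 0 * deriv y t := by
    filter_upwards [hf.eventually_analyticAt, hy.eventually_analyticAt] with t h1 h2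
    exact (h1.differentiableAt.hasDerivAt.sub
      (h2.differentiableAt.hasDerivAt.const_mul (f 0))).deriv
  have hd2 : ∀ᶠ t in 𝓝 (0 : ℂ), deriv (deriv fun t => f t - f 0 * y t) t =
      deriv (deriv f) t - f 0 * deriv (deriv y) t := by
    filter_upwards [hd.eventually_nhds, hf.eventually_analyticAt, hy.eventually_analyticAt]
      with t h h1 h2
    exact ((h1.deriv.differentiableAt.hasDerivAt.sub
      (h2.deriv.differentiableAt.hasDerivAt.const_mul (f 0))).congr_of_eventuallyEq h).deriv
  have := eventually_eq_zero_of_kummer_ode (ν := ν) hμ hg (by simp [hy0]) (by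
    filter_upwards [hd, hd2, hyode, hfode] with t h1 h2 h3 h4
    rw [h1, h2]
    linear_combination h4 - f 0 * h3)
  exact this.mono fun t ht => sub_eq_zero.mp ht

/-! ### Determinants under triangular row and column operations -/

theorem det_eq_of_lowerTriangular_expansion {R : Type*} [CommRing R] (n : ℕ) (M C W : ℕ → ℕ → R)
    (hM : ∀ j < n, ∀ k < n, M j k = ∑ i ∈ Finset.range n, C j i * W i k)
    (hC : ∀ j i, j < i → C j i = 0) :
    (Matrix.of fun j k : Fin n => M j k).det =
      (∏ j ∈ Finset.range n, C j j) * (Matrix.of fun j k : Fin n => W j k).det := by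
  have h : (Matrix.of fun j k : Fin n => M j k) =
      (Matrix.of fun j i : Fin n => C j i) * Matrix.of fun i k : Fin n => W i k := by
    ext j k
    rw [Matrix.mul_apply, Matrix.of_apply, hM j j.2 k k.2, Finset.sum_range]
    rfl
  have hl : (Matrix.of fun j i : Fin n => C j i).IsLowerTriangular := fun i j hij => hC i j hij
  rw [h, Matrix.det_mul, Matrix.det_of_isLowerTriangular (Matrix.of fun j i : Fin n => C j i) hl,
    Finset.prod_range]
  rfl

/-- If the columns of an array obey `s k * a j (k + 1) = a (j + 1) k + c k * a j k`, its
determinant reduces to the Hankel determinant of the first column. -/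
theorem prod_mul_det_eq_hankel {R : Type*} [CommRing R] (n : ℕ) (a : ℕ → ℕ → R) (s c : ℕ → R)
    (h : ∀ j k, s k * a j (k + 1) = a (j + 1) k + c k * a j k) :
    (∏ k ∈ Finset.range n, ∏ i ∈ Finset.range k, s i) *
      (Matrix.of fun j k : Fin n => a j k).det =
      (Matrix.of fun j k : Fin n => a (j + k) 0).det := by
  -- Column k, once scaled, is a unitriangular combination of the shifted first columns. The
  -- coefficients must not depend on the row j, since the induction step also uses row j+1.
  have key : ∀ k : ℕ, ∃ b : ℕ → R, b k = 1 ∧ (∀ i, k < i → b i = 0) ∧ ∀ j N, k < N →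
      (∏ i ∈ Finset.range k, s i) * a j k = ∑ i ∈ Finset.range N, b i * a (j + i) 0 := by
    intro k
    induction k with
    | zero =>
      refine ⟨fun i => if i = 0 then 1 else 0, by simp, fun i hi => by simp [hi.ne'], ?_⟩
      intro j N hN
      simp [hN]
    | succ k ih =>
      obtain ⟨b, hb1, hb0, hb⟩ := ih
      refine ⟨fun i => (if i = 0 then 0 else b (i - 1)) + c k * b i, ?_, ?_, ?_⟩
      · simp [hb1, hb0]
      · intro i hi
        beta_reduce
        rw [if_neg (by omega), hb0 _ (by omega), hb0 _ (by omega)]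
        simp
      · intro j N hN
        obtain ⟨N, rfl⟩ : ∃ N', N = N' + 1 := ⟨N - 1, by omega⟩
        have h1 := hb (j + 1) N (by omega)
        have h2 := hb j (N + 1) (by omega)
        simp_rw [add_mul, Finset.sum_add_distrib, mul_assoc, ← Finset.mul_sum]
        rw [← h2, Finset.sum_range_succ']
        have h3 : ∑ i ∈ Finset.range N, b i * a (j + (i + 1)) 0 =
            ∑ i ∈ Finset.range N, b i * a (j + 1 + i) 0 :=
          Finset.sum_congr rfl fun i _ => by rw [add_right_comm, add_assoc]
        simp only [Nat.add_eq_zero_iff, one_ne_zero, and_false, if_false, Nat.add_sub_cancel, if_true,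
          zero_mul, add_zero]
        rw [h3, ← h1, Finset.prod_range_succ, mul_assoc, h]
        ring
  choose b hb1 hb0 hb using key
  -- Applied to the transpose, so that column operations become a lower triangular left factor.
  have h1 := det_eq_of_lowerTriangular_expansion n
    (fun k j => (∏ i ∈ Finset.range k, s i) * a j k) b (fun i j => a (j + i) 0)
    (fun k hk j _ => hb k j n hk) hb0
  simp only [hb1, Finset.prod_const_one, one_mul] at h1
  have h2 := Matrix.det_mul_column (fun k : Fin n => ∏ i ∈ Finset.range k, s i)
    (Matrix.of fun k j : Fin n => a j k)
  rw [← Finset.prod_range fun k => ∏ i ∈ Finset.range k, s i] at h2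
  rw [← Matrix.det_transpose]
  refine h2.symm.trans (h1.trans ?_)
  rw [← Matrix.det_transpose]
  rfl

/-! ### Iterates of t d/dt -/

section Delta

variable {U : Set ℂ}

theorem DifferentiableOn.delta (hU : IsOpen U) {f : ℂ → ℂ} (hf : DifferentiableOn ℂ f U) :
    DifferentiableOn ℂ (delta f) U :=
  differentiableOn_id.mul (hf.deriv hU)

theorem DifferentiableOn.iterate_delta (hU : IsOpen U) {f : ℂ → ℂ} (hf : DifferentiableOn ℂ f U)
    (j : ℕ) : DifferentiableOn ℂ (PainleveV.delta^[j] f) U := by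
  induction j with
  | zero => exact hf
  | succ j ih => rw [Function.iterate_succ_apply']; exact DifferentiableOn.delta hU ih

theorem delta_const_mul (c : ℂ) (f : ℂ → ℂ) : delta (fun s => c * f s) = fun s => c * delta f s := by
  funext s
  simp only [delta, deriv_const_mul_field]
  ring

theorem iterate_delta_const_mul (c : ℂ) (f : ℂ → ℂ) (j : ℕ) :
    delta^[j] (fun s => c * f s) = fun s => c * delta^[j] f s := by
  induction j with
  | zero => rfl
  | succ j ih =>
    simp_rw [Function.iterate_succ_apply', ih, delta_const_mul]

/-- The coefficients are constants, so δ passes through them; this extends a relation in the row j =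
0 to all rows. -/
theorem iterate_delta_relation (hU : IsOpen U) {F G H : ℂ → ℂ} (a c : ℂ)
    (hF : DifferentiableOn ℂ F U) (hG : DifferentiableOn ℂ G U) (hH : DifferentiableOn ℂ H U)
    (h : ∀ t ∈ U, a * F t = G t + c * H t) (j : ℕ) :
    ∀ t ∈ U, a * delta^[j] F t = delta^[j] G t + c * delta^[j] H t := by
  induction j with
  | zero => exact h
  | succ j ih =>
    intro t ht
    have hn := hU.mem_nhds ht
    have dF := ((DifferentiableOn.iterate_delta hU hF j).differentiableAt hn).hasDerivAt
    have dG := ((DifferentiableOn.iterate_delta hU hG j).differentiableAt hn).hasDerivAt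
    have dH := ((DifferentiableOn.iterate_delta hU hH j).differentiableAt hn).hasDerivAt
    have hE : (fun t => a * delta^[j] F t) =ᶠ[𝓝 t] fun t => delta^[j] G t + c * delta^[j] H t :=
      Filter.eventually_of_mem hn ih
    have := (dF.const_mul a).unique ((dG.add (dH.const_mul c)).congr_of_eventuallyEq hE)
    simp only [Function.iterate_succ_apply', delta] at this ⊢
    linear_combination t * this

/-- Functions raised by `t d/dt` are triangular combinations of their successors. -/
theorem exists_iterate_delta_expansion (hU : IsOpen U) (w : ℤ → ℂ → ℂ)
    (hw : ∀ m, DifferentiableOn ℂ (w m) U)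
    (hδ : ∀ m, ∀ t ∈ U, delta (w m) t = (1 / 2 + t) * w m t + t * w (m + 1) t) (j : ℕ) :
    ∃ C : ℕ → Polynomial ℂ, C j = Polynomial.X ^ j ∧ (∀ i, j < i → C i = 0) ∧
      ∀ (m : ℤ) (N : ℕ), j < N → ∀ t ∈ U,
        delta^[j] (w m) t = ∑ i ∈ Finset.range N, (C i).eval t * w (m + i) t := by
  induction j with
  | zero =>
    refine ⟨fun i => if i = 0 then 1 else 0, by simp, fun i hi => by simp [hi.ne'], ?_⟩
    intro m N hN t _
    rw [Finset.sum_eq_single_of_mem 0 (Finset.mem_range.mpr hN) fun i _ hi => by simp [hi]]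
    simp
  | succ j ih =>
    obtain ⟨C, hC1, hC0, hC⟩ := ih
    -- Leibniz rule for δ(C_i w_{m+i}): the terms t C_i' and (1/2+t) C_i stay at index i, and t C_i
    -- moves to i+1. None depends on m, so one row operation serves all columns.
    refine ⟨fun i => Polynomial.X * Polynomial.derivative (C i) +
      (Polynomial.C (1 / 2) + Polynomial.X) * C i +
      if i = 0 then 0 else Polynomial.X * C (i - 1), ?_, ?_, ?_⟩
    · simp [hC1, hC0, pow_succ']
    · intro i hi
      beta_reduce
      rw [if_neg (by omega), hC0 _ (by omega), hC0 _ (by omega)]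
      simp
    · intro m N hN t ht
      obtain ⟨N, rfl⟩ : ∃ N', N = N' + 1 := ⟨N - 1, by omega⟩
      have hn := hU.mem_nhds ht
      have hE : delta^[j] (w m) =ᶠ[𝓝 t]
          fun t => ∑ i ∈ Finset.range N, (C i).eval t * w (m + i) t :=
        Filter.eventually_of_mem hn (hC m N (by omega))
      have hd : HasDerivAt (fun t => ∑ i ∈ Finset.range N, (C i).eval t * w (m + i) t)
          (∑ i ∈ Finset.range N, ((Polynomial.derivative (C i)).eval t * w (m + i) t +
            (C i).eval t * deriv (w (m + i)) t)) t :=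
        HasDerivAt.fun_sum fun i _ =>
          ((C i).hasDerivAt t).mul ((hw _).differentiableAt hn).hasDerivAt
      rw [Function.iterate_succ_apply', delta, hE.deriv_eq, hd.deriv, Finset.mul_sum]
      have hterm : ∀ i : ℕ, t * ((Polynomial.derivative (C i)).eval t * w (m + i) t +
          (C i).eval t * deriv (w (m + i)) t) =
          (t * (Polynomial.derivative (C i)).eval t + (1 / 2 + t) * (C i).eval t) * w (m + i) t +
            t * (C i).eval t * w (m + (i + 1 : ℕ)) t := by
        intro i
        have := hδ (m + i) t ht
        rw [delta] at this
        have e : m + ((i + 1 : ℕ) : ℤ) = m + i + 1 := by push_cast; ring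
        rw [e]
        linear_combination (C i).eval t * this
      simp_rw [hterm, Finset.sum_add_distrib]
      simp only [Polynomial.eval_add, Polynomial.eval_mul, Polynomial.eval_X, Polynomial.eval_C,
        add_mul _ _ (w _ t), Finset.sum_add_distrib]
      congr 1
      · rw [Finset.sum_range_succ, Finset.sum_range_succ, hC0 N (by omega)]
        simp
      · rw [Finset.sum_range_succ']
        simp

end Delta

/-! ### Raising and lowering operators; from Hankel to Toeplitz -/

/-- `t^{1/2} eᵗ` times the `m`-th shift of the kernel. -/
def raisedKernel (L : ℂ → ℂ) (μ ν : ℂ) (m : ℤ) (t : ℂ) : ℂ :=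
  exp (L t / 2) * exp t * kummerKernel (μ + m) (ν - m) t

section Branch

variable {U : Set ℂ} {L : ℂ → ℂ}

theorem deriv_log_branch (hU : IsOpen U) (hL : DifferentiableOn ℂ L U)
    (hexp : ∀ t ∈ U, exp (L t) = t) {t : ℂ} (ht : t ∈ U) : t * deriv L t = 1 := by
  have hn := hU.mem_nhds ht
  have h1 := (hL.differentiableAt hn).hasDerivAt.cexp
  have h2 : (fun s => exp (L s)) =ᶠ[𝓝 t] id := Filter.eventually_of_mem hn hexp
  have := h1.unique ((hasDerivAt_id t).congr_of_eventuallyEq h2)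
  rwa [hexp t ht] at this

theorem hasDerivAt_raisedKernel (hU : IsOpen U) (hL : DifferentiableOn ℂ L U) (μ ν : ℂ) (m : ℤ)
    {t : ℂ} (ht : t ∈ U) :
    HasDerivAt (raisedKernel L μ ν m)
      ((exp (L t / 2) * (deriv L t / 2) * exp t + exp (L t / 2) * exp t) *
        kummerKernel (μ + m) (ν - m) t +
        exp (L t / 2) * exp t * kummerKernel (μ + m + 1) (ν - m - 1) t) t :=
  ((((hL.differentiableAt (hU.mem_nhds ht)).hasDerivAt.div_const 2).cexp.mul
    (hasDerivAt_exp t)).mul (hasDerivAt_kummerKernel _ _ t))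

theorem differentiableOn_raisedKernel (hU : IsOpen U) (hL : DifferentiableOn ℂ L U) (μ ν : ℂ)
    (m : ℤ) : DifferentiableOn ℂ (raisedKernel L μ ν m) U := fun _ ht =>
  (hasDerivAt_raisedKernel hU hL μ ν m ht).differentiableAt.differentiableWithinAt

theorem delta_raisedKernel (hU : IsOpen U) (hL : DifferentiableOn ℂ L U)
    (hexp : ∀ t ∈ U, exp (L t) = t) (μ ν : ℂ) (m : ℤ) (t : ℂ) (ht : t ∈ U) :
    delta (raisedKernel L μ ν m) t =
      (1 / 2 + t) * raisedKernel L μ ν m t + t * raisedKernel L μ ν (m + 1) t := by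
  have h1 := deriv_log_branch hU hL hexp ht
  rw [delta, (hasDerivAt_raisedKernel hU hL μ ν m ht).deriv]
  have e1 : μ + ((m + 1 : ℤ) : ℂ) = μ + m + 1 := by push_cast; ring
  have e2 : ν - ((m + 1 : ℤ) : ℂ) = ν - m - 1 := by push_cast; ring
  simp only [raisedKernel, e1, e2]
  linear_combination (1 / 2 * exp (L t / 2) * exp t * kummerKernel (μ + m) (ν - m) t) * h1

/-- Eliminate t w_{1-k} between the contiguous relation and the raising relation. The factor t^{1/2}
eᵗ makes the terms t w_{-k} cancel, leaving constant coefficients. -/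
theorem raisedKernel_lower (hU : IsOpen U) (hL : DifferentiableOn ℂ L U)
    (hexp : ∀ t ∈ U, exp (L t) = t) (μ ν : ℂ) (k : ℕ) (t : ℂ) (ht : t ∈ U) :
    (ν + k + 1) * raisedKernel L μ ν (-((k + 1 : ℕ) : ℤ)) t =
      delta (raisedKernel L μ ν (-(k : ℤ))) t + (μ - k - 1 / 2) * raisedKernel L μ ν (-(k : ℤ)) t := by
  rw [delta_raisedKernel hU hL hexp μ ν _ t ht]
  have h := kummerKernel_contiguous (μ - k) (ν + k) t
  have e1 : μ + ((-((k + 1 : ℕ) : ℤ) : ℤ) : ℂ) = μ - k - 1 := by push_cast; ring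
  have e2 : ν - ((-((k + 1 : ℕ) : ℤ) : ℤ) : ℂ) = ν + k + 1 := by push_cast; ring
  have e3 : μ + ((-(k : ℤ) + 1 : ℤ) : ℂ) = μ - k + 1 := by push_cast; ring
  have e4 : ν - ((-(k : ℤ) + 1 : ℤ) : ℂ) = ν + k - 1 := by push_cast; ring
  have e5 : μ + ((-(k : ℤ) : ℤ) : ℂ) = μ - k := by push_cast; ring
  have e6 : ν - ((-(k : ℤ) : ℤ) : ℂ) = ν + k := by push_cast; ring
  simp only [raisedKernel, e1, e2, e3, e4, e5, e6]
  linear_combination (exp (L t / 2) * exp t) * h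

/-- The Toeplitz determinant of shifted kernels. -/
def kernelToeplitz (n : ℕ) (μ ν t : ℂ) : ℂ :=
  (Matrix.of fun j k : Fin n => kummerKernel (μ + j - k) (ν - j + k) t).det

theorem hankel_raisedKernel (hU : IsOpen U) (hL : DifferentiableOn ℂ L U)
    (hexp : ∀ t ∈ U, exp (L t) = t) (μ ν : ℂ) (n : ℕ) {t : ℂ} (ht : t ∈ U) :
    (Matrix.of fun j k : Fin n => (delta^[(j : ℕ) + k] (raisedKernel L μ ν 0)) t).det =
      (∏ k ∈ Finset.range n, ∏ i ∈ Finset.range k, (ν + i + 1)) *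
        (exp ((n : ℂ) ^ 2 / 2 * L t) * exp (n * t)) * kernelToeplitz n μ ν t := by
  have hd := differentiableOn_raisedKernel hU hL μ ν
  have hδ := delta_raisedKernel hU hL hexp μ ν
  have h1 := prod_mul_det_eq_hankel n (fun j k => delta^[j] (raisedKernel L μ ν (-(k : ℤ))) t)
    (fun k => ν + k + 1) (fun k => μ - k - 1 / 2) (fun j k => by
      have := iterate_delta_relation hU (ν + k + 1) (μ - k - 1 / 2) (hd _)
        (DifferentiableOn.delta hU (hd (-(k : ℤ)))) (hd _)
        (raisedKernel_lower hU hL hexp μ ν k) j t ht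
      rwa [← Function.iterate_succ_apply] at this)
  choose C hC1 hC0 hC using exists_iterate_delta_expansion hU _ hd hδ
  have h2 := det_eq_of_lowerTriangular_expansion n
    (fun j k => delta^[j] (raisedKernel L μ ν (-(k : ℤ))) t) (fun j i => (C j i).eval t)
    (fun i k => raisedKernel L μ ν (-(k : ℤ) + i) t) (fun j hj k _ => hC j _ n hj t ht)
    (fun j i hij => by simp [hC0 j i hij])
  have h3 : (Matrix.of fun j k : Fin n => raisedKernel L μ ν (-(k : ℤ) + (j : ℕ)) t) =
      (exp (L t / 2) * exp t) •
        Matrix.of fun j k : Fin n => kummerKernel (μ + j - k) (ν - j + k) t := by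
    ext j k
    simp only [raisedKernel, Matrix.of_apply, Matrix.smul_apply, smul_eq_mul]
    congr 2 <;> push_cast <;> ring
  simp only [hC1, Polynomial.eval_pow, Polynomial.eval_X] at h2
  rw [Finset.prod_pow_eq_pow_sum] at h2
  simp only [Nat.cast_zero, neg_zero] at h1
  rw [← h1, h2, h3, Matrix.det_smul, Fintype.card_fin, kernelToeplitz]
  -- The diagonal contributes t^{n(n-1)/2} and the n entry prefactors t^{n/2}; together they give
  -- t^{n²/2}.
  have hs : ((∑ j ∈ Finset.range n, j : ℕ) : ℂ) + n / 2 = (n : ℂ) ^ 2 / 2 := by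
    have := Finset.sum_range_id_mul_two n
    rcases n with _ | n
    · simp
    · have h : ((∑ j ∈ Finset.range (n + 1), j : ℕ) : ℂ) * 2 = (n + 1) * n := by
        exact_mod_cast this
      push_cast at h ⊢
      linear_combination h / 2
  have hp : t ^ (∑ j ∈ Finset.range n, j) * (exp (L t / 2) * exp t) ^ n =
      exp ((n : ℂ) ^ 2 / 2 * L t) * exp (n * t) := by
    have : t ^ (∑ j ∈ Finset.range n, j) = exp ((∑ j ∈ Finset.range n, j : ℕ) * L t) := by
      rw [exp_nat_mul, hexp t ht]
    rw [this, mul_pow, ← exp_nat_mul, ← exp_nat_mul, ← mul_assoc, ← exp_add, ← hs]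
    congr 2
    ring
  rw [← hp]
  ring

end Branch

theorem tauV_eq_kernelToeplitz (n : ℕ) (t μ ν : ℂ) :
    tauV n t μ ν = Gamma (μ + ν + 1) ^ n * kernelToeplitz n μ ν t := by
  have : tauV n t μ ν = (Gamma (μ + ν + 1) •
      Matrix.of fun j k : Fin n => kummerKernel (μ + j - k) (ν - j + k) t).det := by
    rw [tauV]
    congr 1
    ext j k
    simp only [Matrix.of_apply, Matrix.smul_apply, smul_eq_mul, kummerKernel_eq_oneF1Reg]
    rw [show -ν + (j : ℂ) - k = -(ν - j + k) by ring,
      show μ + 1 + (j : ℂ) - k = μ + j - k + 1 by ring]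
    ring
  rw [this, Matrix.det_smul, Fintype.card_fin, kernelToeplitz]

theorem prod_Gamma_eq {ν : ℂ} (hν : ∀ m : ℕ, ν + 1 ≠ -(m : ℂ)) (n : ℕ) :
    ∏ l ∈ Finset.range n, Gamma (ν + l + 1) =
      Gamma (ν + 1) ^ n * ∏ k ∈ Finset.range n, ∏ i ∈ Finset.range k, (ν + i + 1) := by
  have h : ∀ k : ℕ, Gamma (ν + k + 1) = Gamma (ν + 1) * ∏ i ∈ Finset.range k, (ν + i + 1) := by
    intro k
    induction k with
    | zero => simp
    | succ k ih =>
      have h0 : ν + k + 1 ≠ 0 := fun h => hν k (by linear_combination h)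
      rw [Finset.prod_range_succ, ← mul_assoc, ← ih, Nat.cast_succ, ← add_assoc,
        Gamma_add_one _ h0]
      ring
  simp_rw [h, Finset.prod_mul_distrib, Finset.prod_const, Finset.card_range]

theorem exp_mul_tauVStar_eq {v₁ v₃ v₄ μ ν : ℂ} (h34 : v₃ - v₄ = 0) (h13 : v₁ - v₃ = -ν)
    (hμ : ∀ m : ℕ, μ + 1 ≠ -(m : ℂ)) (hν : ∀ m : ℕ, ν + 1 ≠ -(m : ℂ))
    (hμν : ∀ m : ℕ, μ + ν + 1 ≠ -(m : ℂ)) {τ₁ : ℂ → ℂ}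
    (hτ₁ : ∀ t, exp (ν * t) * τ₁ t = oneF1 (-ν) (μ + 1) (-t))
    {U : Set ℂ} {L : ℂ → ℂ} (hU : IsOpen U) (hL : DifferentiableOn ℂ L U)
    (hexp : ∀ t ∈ U, exp (L t) = t) (n : ℕ) {t : ℂ} (ht : t ∈ U) :
    exp (ν * t) * tauVStar L v₁ v₄ τ₁ n t =
      (Gamma (μ + 1) / Gamma (μ + ν + 1)) ^ n * (∏ l ∈ Finset.range n, Gamma (ν + l + 1)) *
        tauV n t μ ν := by
  have hv : v₄ - v₁ = ν := by linear_combination -h34 - h13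
  -- Since v₄ - v₁ = ν, the exponential e^{νs} turns τ₁ into y, and t^{1/2} eᵗ remains as the
  -- prefactor of w_0.
  have h1 : (fun s => barFactor L v₁ v₄ 1 s * τ₁ s) =
      fun s => Gamma (μ + 1) * Gamma (ν + 1) * raisedKernel L μ ν 0 s := by
    funext s
    have h := hτ₁ s
    rw [oneF1_eq_kummerKernel hμ hν] at h
    simp only [barFactor, raisedKernel, hv, Int.cast_zero, add_zero, sub_zero, Nat.cast_one]
    rw [add_mul, exp_add, one_mul]
    ring_nf at h ⊢
    linear_combination (exp (L s * (1 / 2)) * exp s) * h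
  have h2 : barTau L v₁ v₄ τ₁ n t = (Gamma (μ + 1) * Gamma (ν + 1)) ^ n *
      (Matrix.of fun j k : Fin n => (delta^[(j : ℕ) + k] (raisedKernel L μ ν 0)) t).det := by
    rw [barTau, h1]
    simp_rw [iterate_delta_const_mul]
    have := Matrix.det_smul
      (Matrix.of fun j k : Fin n => (delta^[(j : ℕ) + k] (raisedKernel L μ ν 0)) t)
      (Gamma (μ + 1) * Gamma (ν + 1))
    rw [Fintype.card_fin] at this
    exact this
  have hG := Gamma_ne_zero hμν
  rw [tauVStar, h2, hankel_raisedKernel hU hL hexp μ ν n ht, tauV_eq_kernelToeplitz,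
    prod_Gamma_eq hν, barFactor, hv, add_mul, exp_add]
  rw [div_pow, mul_pow]
  have e1 := exp_ne_zero ((n : ℂ) ^ 2 / 2 * L t)
  have e2 := exp_ne_zero (ν * t)
  have e3 := exp_ne_zero (n * t)
  field_simp

/-! ### Cauchy's beta integral on the circle -/

open MeasureTheory

/-- The weight `z^{(μ-ν)/2} |1 + z|^{μ+ν}` at `z = e^{iθ}`, for `-π ≤ θ ≤ π`. -/
def circleWeight (μ ν : ℂ) (θ : ℝ) : ℂ :=
  exp (I * θ * ((μ - ν) / 2)) * ((2 * Real.cos (θ / 2) : ℝ) : ℂ) ^ (μ + ν)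

theorem norm_one_add_exp (θ : ℝ) (h₁ : -Real.pi ≤ θ) (h₂ : θ ≤ Real.pi) :
    ‖1 + exp (I * θ)‖ = 2 * Real.cos (θ / 2) := by
  have hc : 0 ≤ Real.cos (θ / 2) := Real.cos_nonneg_of_mem_Icc ⟨by linarith, by linarith⟩
  have h : 1 + exp (I * θ) = exp ((θ / 2 : ℝ) * I) * ((2 * Real.cos (θ / 2) : ℝ) : ℂ) := by
    push_cast
    rw [two_cos, mul_add, ← exp_add, ← exp_add]
    ring_nf
    simp [add_comm]
  rw [h, norm_mul, norm_exp_ofReal_mul_I, one_mul, norm_real, Real.norm_of_nonneg (by positivity)]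

theorem two_cos_half_pos {θ : ℝ} (h : θ ∈ Set.Ioo (-Real.pi) Real.pi) :
    0 < 2 * Real.cos (θ / 2) := by
  have := Real.cos_pos_of_mem_Ioo (x := θ / 2) ⟨by linarith [h.1], by linarith [h.2]⟩
  positivity

theorem circleWeight_neg (μ ν : ℂ) (θ : ℝ) : circleWeight μ ν (-θ) = circleWeight ν μ θ := by
  simp only [circleWeight, neg_div, Real.cos_neg, add_comm μ ν]
  congr 2
  push_cast
  ring

theorem intervalIntegrable_cos_cpow {a : ℂ} (ha : -1 < a.re) :
    IntervalIntegrable (fun θ : ℝ => ((2 * Real.cos (θ / 2) : ℝ) : ℂ) ^ a) volume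
      (-Real.pi) Real.pi := by
  have hpi := Real.pi_pos
  have key : IntervalIntegrable (fun θ : ℝ => ((2 * Real.cos (θ / 2) : ℝ) : ℂ) ^ a) volume
      0 Real.pi := by
    rw [intervalIntegrable_iff_integrableOn_Ioo_of_le hpi.le]
    have hm : AEStronglyMeasurable (fun θ : ℝ => ((2 * Real.cos (θ / 2) : ℝ) : ℂ) ^ a)
        volume := by
      refine Measurable.aestronglyMeasurable ?_
      fun_prop
    have hn : ∀ θ ∈ Set.Ioo 0 Real.pi, ‖((2 * Real.cos (θ / 2) : ℝ) : ℂ) ^ a‖ =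
        (2 * Real.cos (θ / 2)) ^ a.re := fun θ hθ =>
      norm_cpow_eq_rpow_re_of_pos (two_cos_half_pos ⟨by linarith [hθ.1], hθ.2⟩) _
    rcases le_or_gt 0 a.re with h0 | h0
    · refine Measure.integrableOn_of_bounded (M := 2 ^ a.re) (by simp) hm ?_
      filter_upwards [ae_restrict_mem measurableSet_Ioo] with θ hθ
      rw [hn θ hθ]
      refine Real.rpow_le_rpow (two_cos_half_pos ⟨by linarith [hθ.1], hθ.2⟩).le ?_ h0
      linarith [Real.cos_le_one (θ / 2)]
    -- For a negative exponent, Jordan's inequality cos x ≥ 1 - 2x/π bounds the singularity at π by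
    -- a power of π - θ that is integrable because Re a > -1.
    · have hg : IntegrableOn (fun θ : ℝ => (2 / Real.pi) ^ a.re * (Real.pi - θ) ^ a.re)
          (Set.Ioo 0 Real.pi) := by
        rw [← intervalIntegrable_iff_integrableOn_Ioo_of_le hpi.le]
        have := (intervalIntegral.intervalIntegrable_rpow' (a := Real.pi) (b := 0) ha).comp_sub_left
          Real.pi
        simp only [sub_self, sub_zero] at this
        exact this.const_mul _
      refine Integrable.mono' hg hm.restrict ?_
      filter_upwards [ae_restrict_mem measurableSet_Ioo] with θ hθ
      have hsub : 0 < Real.pi - θ := by linarith [hθ.2]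
      rw [hn θ hθ, ← Real.mul_rpow (by positivity) hsub.le]
      refine Real.rpow_le_rpow_of_nonpos (by positivity) ?_ h0.le
      have := Real.one_sub_mul_le_cos (x := θ / 2) (by linarith [hθ.1]) (by linarith [hθ.2])
      have e : 2 / Real.pi * (Real.pi - θ) = 2 * (1 - 2 / Real.pi * (θ / 2)) := by
        field_simp
      rw [e]
      linarith
  have key' := key.comp_sub_left 0
  simp only [zero_sub, neg_div, Real.cos_neg, neg_zero] at key'
  exact key'.symm.trans key

theorem intervalIntegrable_circleWeight {μ ν : ℂ} (h : -1 < (μ + ν).re) :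
    IntervalIntegrable (circleWeight μ ν) volume (-Real.pi) Real.pi :=
  (intervalIntegrable_cos_cpow h).continuousOn_mul (by fun_prop)

/-- The unnormalised Cauchy beta integral. -/
def circleIntegralWeight (μ ν : ℂ) : ℂ := ∫ θ in (-Real.pi)..Real.pi, circleWeight μ ν θ

theorem circleIntegralWeight_comm (μ ν : ℂ) :
    circleIntegralWeight μ ν = circleIntegralWeight ν μ := by
  have := intervalIntegral.integral_comp_neg (a := -Real.pi) (b := Real.pi) (circleWeight μ ν)
  simp only [neg_neg, circleWeight_neg] at this
  exact this.symm

/-- Integrate the derivative of e^{iθ(μ+1-ν)/2} (2 cos(θ/2))^{μ+ν+1}; it vanishes at ±π because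
Re(μ+ν+1) > 0. -/
theorem circleIntegralWeight_add_one_left {μ ν : ℂ} (h : -1 < (μ + ν).re) :
    (μ + 1) * circleIntegralWeight (μ + 1) ν = (μ + ν + 1) * circleIntegralWeight μ ν := by
  have ha : μ + ν + 1 ≠ 0 := fun h0 => by
    have := congrArg re h0
    simp only [add_re, one_re, zero_re] at this h
    linarith
  have ha' : μ + ν ≠ -1 := fun h0 => ha (by rw [h0]; ring)
  have hre : 0 < (μ + ν + 1).re := by
    simp only [add_re, one_re] at h ⊢
    linarith
  have hint1 : IntervalIntegrable (circleWeight (μ + 1) ν) volume (-Real.pi) Real.pi :=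
    intervalIntegrable_circleWeight (by rw [add_right_comm]; linarith)
  have hint2 := intervalIntegrable_circleWeight h
  let F : ℝ → ℂ := fun θ => exp (I * θ * ((μ + 1 - ν) / 2)) *
    (((2 * Real.cos (θ / 2) : ℝ) : ℂ) ^ (μ + ν + 1) / (μ + ν + 1))
  have hF : ContinuousOn F (Set.Icc (-Real.pi) Real.pi) := by
    have h1 : Continuous fun θ : ℝ => ((2 * Real.cos (θ / 2) : ℝ) : ℂ) ^ (μ + ν + 1) :=
      (continuous_ofReal_cpow_const hre).comp (by fun_prop)
    refine Continuous.continuousOn ?_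
    exact Continuous.mul (by fun_prop) (h1.div_const _)
  have hd : ∀ θ ∈ Set.Ioo (-Real.pi) Real.pi, HasDerivAt F
      (I / (μ + ν + 1) * ((μ + 1) * circleWeight (μ + 1) ν θ -
        (μ + ν + 1) * circleWeight μ ν θ)) θ := by
    intro θ hθ
    have hc := two_cos_half_pos hθ
    have hc0 : ((2 * Real.cos (θ / 2) : ℝ) : ℂ) ≠ 0 := by exact_mod_cast hc.ne'
    have d1 : HasDerivAt (fun θ : ℝ => 2 * Real.cos (θ / 2)) (-Real.sin (θ / 2)) θ := by
      have := (((hasDerivAt_id θ).div_const 2).cos).const_mul 2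
      refine this.congr_deriv ?_
      simp only [id]
      ring
    have d2 := (hasDerivAt_ofReal_cpow_const' hc.ne' ha').scomp θ d1
    have d3 : HasDerivAt (fun θ : ℝ => exp (I * θ * ((μ + 1 - ν) / 2)))
        (exp (I * θ * ((μ + 1 - ν) / 2)) * (I * 1 * ((μ + 1 - ν) / 2))) θ :=
      (((hasDerivAt_id θ).ofReal_comp.const_mul I).mul_const _).cexp
    refine (d3.mul d2).congr_deriv ?_
    have e1 : exp (I * θ * ((μ + 1 - ν) / 2)) =
        exp (I * θ * ((μ - ν) / 2)) * exp ((θ / 2 : ℝ) * I) := by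
      rw [← exp_add]
      congr 1
      push_cast
      ring
    have e2 : ((2 * Real.cos (θ / 2) : ℝ) : ℂ) ^ (μ + ν + 1) =
        ((2 * Real.cos (θ / 2) : ℝ) : ℂ) ^ (μ + ν) * ((2 * Real.cos (θ / 2) : ℝ) : ℂ) := by
      rw [cpow_add _ _ hc0, cpow_one]
    have e3 : exp ((θ / 2 : ℝ) * I) = Real.cos (θ / 2) + Real.sin (θ / 2) * I := by
      rw [exp_mul_I, ofReal_cos, ofReal_sin]
    have e4 : (Real.cos (θ / 2) : ℂ) ^ 2 + (Real.sin (θ / 2) : ℂ) ^ 2 = 1 := by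
      exact_mod_cast Real.cos_sq_add_sin_sq (θ / 2)
    simp only [circleWeight, Function.comp_apply, add_right_comm μ 1 ν, e1, e2, real_smul]
    rw [e3]
    push_cast
    field_simp
    push_cast at e4
    linear_combination (2 * cos (θ / 2 : ℂ)) ^ (μ + ν) * (μ + ν + 1) *
      (-I * e4 - cos (θ / 2 : ℂ) * sin (θ / 2 : ℂ) * I_sq)
  have hi : IntervalIntegrable (fun θ => I / (μ + ν + 1) * ((μ + 1) * circleWeight (μ + 1) ν θ -
      (μ + ν + 1) * circleWeight μ ν θ)) volume (-Real.pi) Real.pi :=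
    ((hint1.const_mul _).sub (hint2.const_mul _)).const_mul _
  have hftc := intervalIntegral.integral_eq_sub_of_hasDerivAt_of_le
    (by linarith [Real.pi_pos]) hF hd hi
  have hb : F Real.pi = 0 ∧ F (-Real.pi) = 0 := by
    constructor <;> simp [F, neg_div, zero_cpow ha]
  rw [hb.1, hb.2, intervalIntegral.integral_const_mul,
    intervalIntegral.integral_sub (hint1.const_mul _) (hint2.const_mul _),
    intervalIntegral.integral_const_mul, intervalIntegral.integral_const_mul, sub_self,
    mul_eq_zero] at hftc
  exact sub_eq_zero.mp (hftc.resolve_left (div_ne_zero I_ne_zero ha))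

theorem circleIntegralWeight_add_one {μ ν : ℂ} (h : -1 < (μ + ν).re) :
    (μ + 1) * (ν + 1) * circleIntegralWeight (μ + 1) (ν + 1) =
      (μ + ν + 1) * (μ + ν + 2) * circleIntegralWeight μ ν := by
  have h1 := circleIntegralWeight_add_one_left h
  have h2 : (ν + 1) * circleIntegralWeight (ν + 1) (μ + 1) =
      (ν + (μ + 1) + 1) * circleIntegralWeight ν (μ + 1) :=
    circleIntegralWeight_add_one_left (by
      simp only [add_re, one_re] at h ⊢
      linarith)
  rw [circleIntegralWeight_comm, circleIntegralWeight_comm ν] at h2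
  linear_combination (μ + 1) * h2 + (μ + ν + 2) * h1

theorem prod_mul_circleIntegralWeight {μ ν : ℂ} (h : -1 < (μ + ν).re) (N : ℕ) :
    (∏ i ∈ Finset.range N, (μ + 1 + i)) * (∏ i ∈ Finset.range N, (ν + 1 + i)) *
      circleIntegralWeight (μ + N) (ν + N) =
      (∏ i ∈ Finset.range (2 * N), (μ + ν + 1 + i)) * circleIntegralWeight μ ν := by
  induction N with
  | zero => simp
  | succ N ih =>
    have h1 := circleIntegralWeight_add_one (μ := μ + N) (ν := ν + N) (by
      simp only [add_re, natCast_re] at h ⊢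
      have : (0 : ℝ) ≤ N := N.cast_nonneg
      linarith)
    rw [show 2 * (N + 1) = 2 * N + 1 + 1 by ring]
    simp only [Finset.prod_range_succ]
    push_cast
    rw [← add_assoc, ← add_assoc]
    linear_combination ((∏ i ∈ Finset.range N, (μ + 1 + i)) *
      (∏ i ∈ Finset.range N, (ν + 1 + i))) * h1 + (μ + N + (ν + N) + 1) * (μ + N + (ν + N) + 2) * ih

theorem circleIntegralWeight_zero : circleIntegralWeight 0 0 = 2 * Real.pi := by
  simp [circleIntegralWeight, circleWeight]
  ring

theorem circleIntegralWeight_nat (N : ℕ) :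
    (N.factorial : ℂ) ^ 2 * circleIntegralWeight N N = (2 * N).factorial * (2 * Real.pi) := by
  have := prod_mul_circleIntegralWeight (μ := 0) (ν := 0) (by simp) N
  simp only [zero_add, circleIntegralWeight_zero] at this
  have hf : ∀ M : ℕ, ∏ i ∈ Finset.range M, (1 + (i : ℂ)) = M.factorial := fun M => by
    rw [← Finset.prod_range_add_one_eq_factorial]
    push_cast
    exact Finset.prod_congr rfl fun i _ => add_comm _ _
  rw [hf, hf] at this
  rw [← this]
  ring

theorem circleWeight_add_nat {μ ν : ℂ} {θ : ℝ} (hθ : θ ∈ Set.Ioo (-Real.pi) Real.pi) (N : ℕ) :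
    circleWeight (μ + N) (ν + N) θ =
      ((2 * Real.cos (θ / 2)) ^ 2) ^ N • circleWeight μ ν θ := by
  have hc0 : ((2 * Real.cos (θ / 2) : ℝ) : ℂ) ≠ 0 := by exact_mod_cast (two_cos_half_pos hθ).ne'
  have e : μ + N + (ν + N) = μ + ν + (2 * N : ℕ) := by push_cast; ring
  simp only [circleWeight, add_sub_add_right_eq_sub, e, cpow_add _ _ hc0, cpow_natCast, real_smul]
  rw [pow_mul]
  push_cast
  ring

theorem circleIntegralWeight_add_nat (μ ν : ℂ) (N : ℕ) :
    circleIntegralWeight (μ + N) (ν + N) = ∫ θ in Set.Icc (-Real.pi) Real.pi,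
      ((2 * Real.cos (θ / 2)) ^ 2) ^ N • circleWeight μ ν θ := by
  rw [circleIntegralWeight, intervalIntegral.integral_of_le (by linarith [Real.pi_pos]),
    integral_Ioc_eq_integral_Ioo, integral_Icc_eq_integral_Ioo]
  exact setIntegral_congr_fun measurableSet_Ioo fun θ hθ => circleWeight_add_nat hθ N

/-- Laplace's method: the normalised densities (2 cos(θ/2))^{2N} concentrate at θ = 0, where the
weight equals 2^{μ+ν}. -/
theorem tendsto_circleIntegralWeight_ratio {μ ν : ℂ} (h : -1 < (μ + ν).re) :
    Tendsto (fun N : ℕ => circleIntegralWeight (μ + N) (ν + N) / circleIntegralWeight N N) atTop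
      (𝓝 (2 ^ (μ + ν))) := by
  have hpi := Real.pi_pos
  have h0 : ∀ N : ℕ, circleIntegralWeight N N =
      ((∫ θ in Set.Icc (-Real.pi) Real.pi, ((2 * Real.cos (θ / 2)) ^ 2) ^ N : ℝ) : ℂ) := by
    intro N
    have := circleIntegralWeight_add_nat 0 0 N
    simp only [zero_add] at this
    rw [this, ← integral_complex_ofReal]
    congr 1
    funext θ
    simp [circleWeight]
  have key := tendsto_setIntegral_pow_smul_of_unique_maximum_of_isCompact_of_integrableOn
    (μ := volume) (s := Set.Icc (-Real.pi) Real.pi) (x₀ := 0) isCompact_Icc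
    (c := fun θ : ℝ => (2 * Real.cos (θ / 2)) ^ 2) (g := circleWeight μ ν)
    (by fun_prop) ?_ (fun _ _ => sq_nonneg _) (by simp) ?_ ?_ ?_
  · have e0 : circleWeight μ ν 0 = 2 ^ (μ + ν) := by simp [circleWeight]
    rw [e0] at key
    refine key.congr fun N => ?_
    rw [circleIntegralWeight_add_nat, h0, real_smul, ofReal_inv, div_eq_inv_mul]
  · intro θ hθ hne
    have h1 : Real.cos (θ / 2) < 1 := by
      refine lt_of_le_of_ne (Real.cos_le_one _) fun h1 => hne ?_
      have := (Real.cos_eq_one_iff_of_lt_of_lt (x := θ / 2) (by linarith [hθ.1])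
        (by linarith [hθ.2])).mp h1
      linarith
    have h2 : 0 ≤ Real.cos (θ / 2) :=
      Real.cos_nonneg_of_mem_Icc ⟨by linarith [hθ.1], by linarith [hθ.2]⟩
    simp only [zero_div, Real.cos_zero]
    nlinarith
  · rw [interior_Icc]
    exact subset_closure ⟨by linarith, hpi⟩
  · rw [← intervalIntegrable_iff_integrableOn_Icc_of_le (by linarith)]
    exact intervalIntegrable_circleWeight h
  · refine ContinuousAt.continuousWithinAt ?_
    have h1 : ContinuousAt (fun θ : ℝ => ((2 * Real.cos (θ / 2) : ℝ) : ℂ) ^ (μ + ν)) 0 :=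
      ContinuousAt.cpow (by fun_prop) continuousAt_const (by simp)
    exact ContinuousAt.mul (by fun_prop) h1

/-- At a pole the finite product in Euler's limit eventually contains the factor 0, so the limit
agrees with 1/Γ = 0. -/
theorem tendsto_inv_GammaSeq (s : ℂ) :
    Tendsto (fun n => (GammaSeq s n)⁻¹) atTop (𝓝 (Gamma s)⁻¹) := by
  by_cases h : Gamma s = 0
  · obtain ⟨m, rfl⟩ := (Gamma_eq_zero_iff s).mp h
    rw [h, inv_zero]
    refine tendsto_const_nhds.congr' ?_
    filter_upwards [eventually_ge_atTop m] with n hn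
    have : ∏ j ∈ Finset.range (n + 1), (-(m : ℂ) + j) = 0 :=
      Finset.prod_eq_zero (Finset.mem_range.mpr (by omega : m < n + 1)) (by simp)
    rw [GammaSeq, this, div_zero, inv_zero]
  · exact (GammaSeq_tendsto_Gamma s).inv₀ h

theorem prod_eq_inv_GammaSeq (s : ℂ) {n : ℕ} (hn : n ≠ 0) :
    ∏ j ∈ Finset.range (n + 1), (s + j) = (GammaSeq s n)⁻¹ * ((n : ℂ) ^ s * n.factorial) := by
  have h1 : (n : ℂ) ^ s ≠ 0 := by simp [cpow_eq_zero_iff, hn]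
  have h2 : (n.factorial : ℂ) ≠ 0 := by exact_mod_cast n.factorial_ne_zero
  rw [GammaSeq, inv_div, div_mul_cancel₀ _ (mul_ne_zero h1 h2)]

/-- Cauchy's beta integral. -/
theorem circleIntegralWeight_eq {μ ν : ℂ} (h : -1 < (μ + ν).re) :
    circleIntegralWeight μ ν =
      2 * Real.pi * (Gamma (μ + ν + 1) * ((Gamma (μ + 1))⁻¹ * (Gamma (ν + 1))⁻¹)) := by
  set J := circleIntegralWeight μ ν
  have hΓ : Gamma (μ + ν + 1) ≠ 0 := Gamma_ne_zero_of_re_pos (by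
    simp only [add_re, one_re] at h ⊢
    linarith)
  -- The recurrence iterated n+1 times has products of n+1, n+1 and 2n+2 factors, that is Euler's
  -- sequences at n, n and 2n+1. Their powers of n and 2n+1 combine to n · x(n)^{μ+ν+1}.
  let x : ℕ → ℝ := fun n => n / (2 * n + 1)
  have hx : Tendsto x atTop (𝓝 (1 / 2)) := by
    have h1 : Tendsto (fun n : ℕ => 1 / (2 + 1 / (n : ℝ))) atTop (𝓝 (1 / (2 + 0))) :=
      tendsto_const_nhds.div (tendsto_const_nhds.add tendsto_one_div_atTop_nhds_zero_nat)
        (by norm_num)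
    rw [add_zero] at h1
    refine h1.congr' ?_
    filter_upwards [eventually_ne_atTop 0] with n hn
    have : (n : ℝ) ≠ 0 := by exact_mod_cast hn
    simp only [x]
    field_simp
  have hxc : Tendsto (fun n => ((x n : ℝ) : ℂ) ^ (μ + ν + 1)) atTop
      (𝓝 ((1 / 2 : ℂ) ^ (μ + ν + 1))) := by
    have h1 : Tendsto (fun n => ((x n : ℝ) : ℂ)) atTop (𝓝 (((1 / 2 : ℝ) : ℝ) : ℂ)) :=
      (continuous_ofReal.tendsto _).comp hx
    have h2 := h1.cpow (tendsto_const_nhds (x := μ + ν + 1)) (Or.inl (by norm_num))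
    simpa using h2
  have hodd : Tendsto (fun n : ℕ => 2 * n + 1) atTop atTop :=
    tendsto_atTop_mono (fun n => by simp only [id]; omega) tendsto_id
  have hshift := tendsto_add_atTop_nat 1
  have hR := (tendsto_circleIntegralWeight_ratio h).comp hshift
  have hq : Tendsto (fun n : ℕ => (n : ℂ) / (n + 1)) atTop (𝓝 1) :=
    tendsto_natCast_div_add_atTop 1
  have hlim1 := ((tendsto_inv_GammaSeq (μ + ν + 1)).comp hodd).mul_const J
  have hlim2 := (((((tendsto_inv_GammaSeq (μ + 1)).mul (tendsto_inv_GammaSeq (ν + 1))).mul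
    hR).mul hq).mul hxc).mul_const (4 * (Real.pi : ℂ))
  have heq : ∀ᶠ n : ℕ in atTop, (GammaSeq (μ + ν + 1) (2 * n + 1))⁻¹ * J =
      (GammaSeq (μ + 1) n)⁻¹ * (GammaSeq (ν + 1) n)⁻¹ *
        (circleIntegralWeight (μ + (n + 1 : ℕ)) (ν + (n + 1 : ℕ)) /
          circleIntegralWeight (n + 1 : ℕ) (n + 1 : ℕ)) * ((n : ℂ) / (n + 1)) *
        ((x n : ℝ) : ℂ) ^ (μ + ν + 1) * (4 * (Real.pi : ℂ)) := by
    filter_upwards [eventually_ne_atTop 0] with n hn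
    have hn0 : (n : ℂ) ≠ 0 := by exact_mod_cast hn
    have hn1 : (n : ℂ) + 1 ≠ 0 := by exact_mod_cast n.succ_ne_zero
    have hn2 : 2 * (n : ℂ) + 1 ≠ 0 := by exact_mod_cast (2 * n).succ_ne_zero
    have h1 := prod_mul_circleIntegralWeight h (n + 1)
    rw [show 2 * (n + 1) = 2 * n + 1 + 1 by ring, prod_eq_inv_GammaSeq _ hn,
      prod_eq_inv_GammaSeq _ hn, prod_eq_inv_GammaSeq _ (by omega : 2 * n + 1 ≠ 0)] at h1
    have h2 := circleIntegralWeight_nat (n + 1)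
    have h3 : ((2 * (n + 1)).factorial : ℂ) = (2 * n + 2) * (2 * n + 1).factorial := by
      rw [show 2 * (n + 1) = 2 * n + 1 + 1 by ring, Nat.factorial_succ]
      push_cast
      ring
    have h4 : ((n + 1).factorial : ℂ) = (n + 1) * n.factorial := by
      rw [Nat.factorial_succ]
      push_cast
      ring
    have hf1 : (n.factorial : ℂ) ≠ 0 := by exact_mod_cast n.factorial_ne_zero
    have hf2 : ((2 * n + 1).factorial : ℂ) ≠ 0 := by exact_mod_cast (2 * n + 1).factorial_ne_zero
    have hpi : (Real.pi : ℂ) ≠ 0 := by exact_mod_cast Real.pi_ne_zero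
    have hpow : (n : ℂ) ^ (μ + 1) * (n : ℂ) ^ (ν + 1) =
        n * (((x n : ℝ) : ℂ) ^ (μ + ν + 1) * ((2 * n + 1 : ℕ) : ℂ) ^ (μ + ν + 1)) := by
      have e1 : ((x n : ℝ) : ℂ) ^ (μ + ν + 1) * ((2 * n + 1 : ℕ) : ℂ) ^ (μ + ν + 1) =
          (n : ℂ) ^ (μ + ν + 1) := by
        rw [← ofReal_natCast (2 * n + 1), ← mul_cpow_ofReal_nonneg (by positivity) (by positivity),
          ← ofReal_mul]
        congr 1
        simp only [x]
        push_cast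
        rw [div_mul_cancel₀ _ hn2]
      rw [e1, ← cpow_add _ _ hn0, show μ + 1 + (ν + 1) = 1 + (μ + ν + 1) by ring,
        cpow_add _ _ hn0, cpow_one]
    have hM : ((2 * n + 1 : ℕ) : ℂ) ^ (μ + ν + 1) ≠ 0 := by
      rw [Ne, cpow_eq_zero_iff, not_and_or]
      exact Or.inl (by exact_mod_cast (2 * n).succ_ne_zero)
    rw [h3, h4] at h2
    have hJN : circleIntegralWeight (n + 1 : ℕ) (n + 1 : ℕ) =
        4 * Real.pi * (2 * n + 1).factorial / ((n + 1) * (n.factorial : ℂ) ^ 2) := by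
      rw [eq_div_iff (by positivity)]
      refine mul_left_cancel₀ hn1 ?_
      linear_combination h2
    rw [hJN]
    refine mul_right_cancel₀ (mul_ne_zero hM hf2) ?_
    rw [mul_right_comm _ J, ← h1]
    field_simp
    linear_combination ((GammaSeq (μ + 1) n)⁻¹ * (GammaSeq (ν + 1) n)⁻¹ *
      circleIntegralWeight (μ + (n + 1 : ℕ)) (ν + (n + 1 : ℕ))) * hpow
  have huniq := tendsto_nhds_unique (hlim1.congr' heq) hlim2
  -- The Laplace limit times the limit of x(n)^{μ+ν+1} is 1/2, which turns 4π into 2π.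
  have hhalf : (2 : ℂ) ^ (μ + ν) * (1 / 2 : ℂ) ^ (μ + ν + 1) = 1 / 2 := by
    have e : (2 : ℂ) ^ (μ + ν) * (1 / 2 : ℂ) ^ (μ + ν) = 1 := by
      have := mul_cpow_ofReal_nonneg (a := 2) (b := 1 / 2) (by norm_num) (by norm_num) (μ + ν)
      push_cast at this
      rw [← this]
      norm_num
    rw [cpow_add (μ + ν) 1 (by norm_num : (1 / 2 : ℂ) ≠ 0), cpow_one, ← mul_assoc, e, one_mul]
  have : (Gamma (μ + ν + 1))⁻¹ * J = (Gamma (μ + 1))⁻¹ * (Gamma (ν + 1))⁻¹ * (2 * Real.pi) := by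
    rw [huniq]
    linear_combination ((Gamma (μ + 1))⁻¹ * (Gamma (ν + 1))⁻¹ * (4 * Real.pi)) * hhalf
  rw [inv_mul_eq_iff_eq_mul₀ hΓ] at this
  rw [this]
  ring

/-! ### Fourier coefficients and the unitary average -/

theorem circleWeight_shift (μ ν s : ℂ) (θ : ℝ) :
    circleWeight (μ + s) (ν - s) θ = circleWeight μ ν θ * exp (s * (I * θ)) := by
  have e : μ + s + (ν - s) = μ + ν := by ring
  simp only [circleWeight, e]
  rw [mul_right_comm (exp _) _ (exp _), ← exp_add]
  congr 2
  ring

/-- Expand e^{tz}: multiplication by zᵖ shifts the weight to (μ+p, ν-p), preserving its modulus and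
μ+ν. The exponential series therefore justifies the interchange, and the beta integrals sum to the
kernel. -/
theorem integral_circleWeight_mul_exp {μ ν : ℂ} (h : -1 < (μ + ν).re) (t : ℂ) :
    ∫ θ in Set.Ioc (-Real.pi) Real.pi, circleWeight μ ν θ * exp (t * exp (I * θ)) =
      2 * Real.pi * (Gamma (μ + ν + 1) * kummerKernel μ ν t) := by
  have hle : -Real.pi ≤ Real.pi := by linarith [Real.pi_pos]
  have hint : ∀ p : ℕ, IntegrableOn (circleWeight (μ + p) (ν - p)) (Set.Ioc (-Real.pi) Real.pi) :=
    fun p => (intervalIntegrable_iff_integrableOn_Ioc_of_le hle).mp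
      (intervalIntegrable_circleWeight (by rwa [add_add_sub_cancel]))
  have hF : ∀ p : ℕ, ∀ θ : ℝ, circleWeight μ ν θ * ((t * exp (I * θ)) ^ p / (p.factorial : ℂ)) =
      t ^ p / (p.factorial : ℂ) * circleWeight (μ + p) (ν - p) θ := by
    intro p θ
    rw [circleWeight_shift, exp_nat_mul, mul_pow]
    ring
  have hnorm : ∀ p : ℕ, ∀ θ : ℝ, ‖circleWeight (μ + p) (ν - p) θ‖ = ‖circleWeight μ ν θ‖ := by
    intro p θ
    rw [circleWeight_shift, norm_mul, exp_nat_mul, norm_pow, mul_comm I, norm_exp_ofReal_mul_I]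
    simp
  have hsum := hasSum_integral_of_summable_integral_norm
    (μ := volume.restrict (Set.Ioc (-Real.pi) Real.pi))
    (F := fun (p : ℕ) θ => t ^ p / (p.factorial : ℂ) * circleWeight (μ + p) (ν - p) θ)
    (fun p => (hint p).const_mul _) (by
      simp_rw [norm_mul, hnorm, integral_const_mul, norm_div, norm_pow, norm_natCast]
      exact (Real.summable_pow_div_factorial ‖t‖).mul_right _)
  have hexp : ∀ θ : ℝ, ∑' p : ℕ, t ^ p / (p.factorial : ℂ) * circleWeight (μ + p) (ν - p) θ =
      circleWeight μ ν θ * exp (t * exp (I * θ)) := by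
    intro θ
    simp_rw [← hF, tsum_mul_left]
    rw [exp_eq_exp_ℂ, NormedSpace.exp_eq_tsum_div]
  simp_rw [hexp] at hsum
  refine hsum.unique ?_
  have hk := ((hasSum_kummerKernel μ ν t).mul_left (Gamma (μ + ν + 1))).mul_left (2 * (Real.pi : ℂ))
  refine hk.congr_fun fun p => ?_
  have hJ := circleIntegralWeight_eq (μ := μ + p) (ν := ν - p) (by rwa [add_add_sub_cancel])
  rw [circleIntegralWeight, intervalIntegral.integral_of_le hle, add_add_sub_cancel] at hJ
  rw [integral_const_mul, hJ]
  ring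

/-- Andréief's integration formula. -/
theorem integral_det_mul_det {α : Type*} [MeasurableSpace α] (m : Measure α) [SigmaFinite m] (n : ℕ)
    (w : α → ℂ) (f g : Fin n → α → ℂ) (hint : ∀ j k, Integrable (fun x => w x * f j x * g k x) m) :
    ∫ x : Fin n → α, (∏ l, w (x l)) * ((Matrix.of fun j l => f j (x l)).det *
      (Matrix.of fun j l => g j (x l)).det) ∂(Measure.pi fun _ => m) =
      n.factorial * (Matrix.of fun j k => ∫ x, w x * f j x * g k x ∂m).det := by
  have hexpand : ∀ x : Fin n → α, (∏ l, w (x l)) * ((Matrix.of fun j l => f j (x l)).det *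
      (Matrix.of fun j l => g j (x l)).det) = ∑ τ : Equiv.Perm (Fin n), ∑ σ : Equiv.Perm (Fin n),
        ((Equiv.Perm.sign τ : ℤ) : ℂ) * ((Equiv.Perm.sign σ : ℤ) : ℂ) *
          ∏ l, (w (x l) * f (σ l) (x l) * g (τ l) (x l)) := by
    intro x
    simp only [Matrix.det_apply', Matrix.of_apply]
    rw [Finset.sum_mul_sum, Finset.sum_comm, Finset.mul_sum]
    refine Finset.sum_congr rfl fun τ _ => ?_
    rw [Finset.mul_sum]
    refine Finset.sum_congr rfl fun σ _ => ?_
    simp only [Finset.prod_mul_distrib]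
    ring
  have hi : ∀ τ σ : Equiv.Perm (Fin n), Integrable (fun x : Fin n → α =>
      ((Equiv.Perm.sign τ : ℤ) : ℂ) * ((Equiv.Perm.sign σ : ℤ) : ℂ) *
        ∏ l, (w (x l) * f (σ l) (x l) * g (τ l) (x l))) (Measure.pi fun _ => m) := fun τ σ =>
    (Integrable.fintype_prod (f := fun l y => w y * f (σ l) y * g (τ l) y)
      fun l => hint _ _).const_mul _
  simp_rw [hexpand]
  rw [integral_finsetSum _ fun τ _ => integrable_finsetSum _ fun σ _ => hi τ σ]
  -- For fixed τ, the sum over σ is the determinant with columns permuted by τ; the two signs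
  -- cancel, so all n! values of τ contribute equally.
  have hτ : ∀ τ : Equiv.Perm (Fin n), ∫ x : Fin n → α, ∑ σ : Equiv.Perm (Fin n),
      ((Equiv.Perm.sign τ : ℤ) : ℂ) * ((Equiv.Perm.sign σ : ℤ) : ℂ) *
        ∏ l, (w (x l) * f (σ l) (x l) * g (τ l) (x l)) ∂(Measure.pi fun _ => m) =
      (Matrix.of fun j k => ∫ x, w x * f j x * g k x ∂m).det := by
    intro τ
    rw [integral_finsetSum _ fun σ _ => hi τ σ]
    have hp := Matrix.det_permute' τ (Matrix.of fun j k => ∫ x, w x * f j x * g k x ∂m)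
    rw [Matrix.det_apply'] at hp
    have hs : ((Equiv.Perm.sign τ : ℤ) : ℂ) * ((Equiv.Perm.sign τ : ℤ) : ℂ) = 1 := by
      rw [← Int.cast_mul, ← Units.val_mul, Int.units_mul_self, Units.val_one, Int.cast_one]
    rw [← one_mul (Matrix.det _), ← hs, mul_assoc, ← hp, Finset.mul_sum]
    refine Finset.sum_congr rfl fun σ _ => ?_
    rw [integral_const_mul, integral_fintype_prod_eq_prod
      (f := fun l y => w y * f (σ l) y * g (τ l) y), mul_assoc]
    rfl
  simp_rw [hτ]
  rw [Finset.sum_const, Finset.card_univ, Fintype.card_perm, Fintype.card_fin, nsmul_eq_mul]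

/-- A Vandermonde determinant times its conjugate, which is the form Andréief's formula needs. -/
theorem prod_norm_sq_eq_det_mul_det {n : ℕ} (z : Fin n → ℂ) :
    ((∏ j, ∏ k ∈ Finset.Ioi j, ‖z k - z j‖ ^ 2 : ℝ) : ℂ) =
      (Matrix.of fun j l : Fin n => z l ^ (j : ℕ)).det *
        (Matrix.of fun j l : Fin n => (starRingEnd ℂ) (z l) ^ (j : ℕ)).det := by
  have h : ∀ v : Fin n → ℂ, (Matrix.of fun j l : Fin n => v l ^ (j : ℕ)).det =
      ∏ j, ∏ k ∈ Finset.Ioi j, (v k - v j) := by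
    intro v
    rw [← Matrix.det_vandermonde, ← Matrix.det_transpose]
    rfl
  rw [h, h, ← Finset.prod_mul_distrib]
  push_cast
  refine Finset.prod_congr rfl fun j _ => ?_
  rw [← Finset.prod_mul_distrib]
  refine Finset.prod_congr rfl fun k _ => ?_
  rw [← map_sub, mul_conj, normSq_eq_norm_sq]
  push_cast
  rfl

/-- Andréief with f_j = zʲ and g_k = z̄ᵏ: on the circle their product is z^{j-k}, a shift of the
weight by j-k. The factor n! (2π)ⁿ cancels the normalisation. -/
theorem tauVAverage_eq_tauV (n : ℕ) (t : ℂ) {μ ν : ℂ} (h : -1 < (μ + ν).re) :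
    tauVAverage n t μ ν = tauV n t μ ν := by
  have hle : -Real.pi ≤ Real.pi := by linarith [Real.pi_pos]
  let w : ℝ → ℂ := fun θ => circleWeight μ ν θ * exp (t * exp (I * θ))
  let f : Fin n → ℝ → ℂ := fun j θ => exp (I * θ) ^ (j : ℕ)
  let g : Fin n → ℝ → ℂ := fun j θ => (starRingEnd ℂ) (exp (I * θ)) ^ (j : ℕ)
  have hw : ∀ (j k : Fin n) (θ : ℝ), w θ * f j θ * g k θ =
      circleWeight (μ + j - k) (ν - j + k) θ * exp (t * exp (I * θ)) := by
    intro j k θ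
    have e : circleWeight (μ + j - k) (ν - j + k) θ =
        circleWeight (μ + ((j : ℂ) - k)) (ν - ((j : ℂ) - k)) θ := by
      congr 1 <;> ring
    have hc : (starRingEnd ℂ) (exp (I * θ)) = exp (-(I * θ)) := by
      rw [← exp_conj, map_mul, conj_I, conj_ofReal, neg_mul]
    have e2 : ((j : ℂ) - k) * (I * θ) = j * (I * θ) + k * (-(I * θ)) := by ring
    rw [e, circleWeight_shift, e2, exp_add, exp_nat_mul, exp_nat_mul]
    simp only [w, f, g, hc]
    ring
  have hre : ∀ j k : Fin n, -1 < (μ + j - k + (ν - j + k)).re := by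
    intro j k
    rwa [show μ + j - k + (ν - j + k) = μ + ν by ring]
  have hint : ∀ j k : Fin n, Integrable (fun θ => w θ * f j θ * g k θ)
      (volume.restrict (Set.Ioc (-Real.pi) Real.pi)) := by
    intro j k
    simp_rw [hw]
    exact (intervalIntegrable_iff_integrableOn_Ioc_of_le hle).mp
      ((intervalIntegrable_circleWeight (hre j k)).mul_continuousOn (by fun_prop))
  have key := integral_det_mul_det (volume.restrict (Set.Ioc (-Real.pi) Real.pi)) n w f g hint
  have hentry : ∀ j k : Fin n, ∫ θ in Set.Ioc (-Real.pi) Real.pi, w θ * f j θ * g k θ =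
      2 * Real.pi * (Gamma (μ + ν + 1) * kummerKernel (μ + j - k) (ν - j + k) t) := by
    intro j k
    simp_rw [hw]
    rw [integral_circleWeight_mul_exp (hre j k),
      show μ + j - k + (ν - j + k) = μ + ν by ring]
  have hdet : (Matrix.of fun j k : Fin n =>
      ∫ θ in Set.Ioc (-Real.pi) Real.pi, w θ * f j θ * g k θ).det =
      (2 * (Real.pi : ℂ)) ^ n * tauV n t μ ν := by
    rw [tauV_eq_kernelToeplitz, ← mul_assoc, ← mul_pow, kernelToeplitz]
    have := Matrix.det_smul (Matrix.of fun j k : Fin n => kummerKernel (μ + j - k) (ν - j + k) t)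
      (2 * (Real.pi : ℂ) * Gamma (μ + ν + 1))
    rw [Fintype.card_fin] at this
    rw [← this]
    congr 1
    ext j k
    rw [Matrix.of_apply, hentry, Matrix.smul_apply, Matrix.of_apply, smul_eq_mul]
    ring
  rw [hdet, ← Measure.restrict_pi_pi, ← volume_pi] at key
  have hpi : (Real.pi : ℂ) ≠ 0 := by exact_mod_cast Real.pi_ne_zero
  have hn : (n.factorial : ℂ) ≠ 0 := by exact_mod_cast n.factorial_ne_zero
  have hcongr : ∫ θ : Fin n → ℝ in Set.univ.pi fun _ => Set.Ioc (-Real.pi) Real.pi,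
      (∏ l, (exp (I * θ l * ((μ - ν) / 2)) *
          ((‖1 + exp (I * θ l)‖ : ℝ) : ℂ) ^ (μ + ν) * exp (t * exp (I * θ l)))) *
        ((∏ j, ∏ k ∈ Finset.Ioi j, ‖exp (I * θ k) - exp (I * θ j)‖ ^ 2 : ℝ) : ℂ) =
      ∫ θ : Fin n → ℝ in Set.univ.pi fun _ => Set.Ioc (-Real.pi) Real.pi,
        (∏ l, w (θ l)) * ((Matrix.of fun j l => f j (θ l)).det *
          (Matrix.of fun j l => g j (θ l)).det) := by
    refine setIntegral_congr_fun (MeasurableSet.univ_pi fun _ => measurableSet_Ioc) fun θ hθ => ?_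
    have h1 := prod_norm_sq_eq_det_mul_det fun l => exp (I * θ l)
    rw [h1]
    congr 1
    refine Finset.prod_congr rfl fun l _ => ?_
    have hl := hθ l (Set.mem_univ l)
    rw [norm_one_add_exp _ hl.1.le hl.2]
    rfl
  rw [tauVAverage, hcongr, key]
  field_simp

end PainleveV
end

/-! ### The main theorem -/

theorem mainTheorem7 (v₁ v₂ v₃ v₄ μ ν : ℂ)
    (h34 : v₃ - v₄ = 0) (h13 : v₁ - v₃ = -ν) (h12 : v₁ - v₂ = μ)
    (hμ : ∀ m : ℕ, μ + 1 ≠ -(m : ℂ))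
    (hν : ∀ m : ℕ, ν + 1 ≠ -(m : ℂ))
    (hμν : ∀ m : ℕ, μ + ν + 1 ≠ -(m : ℂ))
    (y τ₁ : ℂ → ℂ)
    (hy : ∀ t : ℂ, y t = PainleveV.oneF1 (v₁ - v₃) (v₁ - v₂ + 1) (-t))
    (hτ₁ : ∀ t : ℂ, Complex.exp (-(v₁ - v₃) * t) * τ₁ t = y t) :
    -- `y` is, up to a constant factor, the solution of the equation analytic at the origin
    ((AnalyticAt ℂ y 0 ∧ y 0 = 1 ∧ ∀ t : ℂ, PainleveV.SatisfiesODE v₁ v₂ v₃ y t) ∧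
      ∀ f : ℂ → ℂ, AnalyticAt ℂ f 0 →
        (∀ᶠ t in nhds (0 : ℂ), PainleveV.SatisfiesODE v₁ v₂ v₃ f t) →
        ∀ᶠ t in nhds (0 : ℂ), f t = f 0 * y t) ∧
    -- the identification, on every domain of a holomorphic branch `L` of the logarithm
    ∀ (U : Set ℂ) (L : ℂ → ℂ), IsOpen U → DifferentiableOn ℂ L U →
      (∀ t ∈ U, Complex.exp (L t) = t) →
      ∀ (n : ℕ), ∀ t ∈ U,
        Complex.exp (ν * t) * PainleveV.tauVStar L v₁ v₄ τ₁ n t =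
            (Complex.Gamma (μ + 1) / Complex.Gamma (μ + ν + 1)) ^ n *
              (∏ l ∈ Finset.range n, Complex.Gamma (ν + (l : ℂ) + 1)) *
              PainleveV.tauV n t μ ν ∧
        (-1 < (μ + ν).re →
          Complex.exp (ν * t) * PainleveV.tauVStar L v₁ v₄ τ₁ n t =
            (Complex.Gamma (μ + 1) / Complex.Gamma (μ + ν + 1)) ^ n *
              (∏ l ∈ Finset.range n, Complex.Gamma (ν + (l : ℂ) + 1)) *
              PainleveV.tauVAverage n t μ ν) := by
  obtain rfl : v₂ = v₁ - μ := by linear_combination -h12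
  have h12' : v₁ - (v₁ - μ) = μ := by ring
  have hy' : y = fun t => Complex.Gamma (μ + 1) * Complex.Gamma (ν + 1) *
      PainleveV.kummerKernel μ ν t := by
    funext t
    rw [hy, h13, h12', PainleveV.oneF1_eq_kummerKernel hμ hν]
  have hy0 : y 0 = 1 := by
    have h1 := Complex.Gamma_ne_zero hμ
    have h2 := Complex.Gamma_ne_zero hν
    simp only [hy', PainleveV.kummerKernel_zero]
    field_simp
  have hya : AnalyticAt ℂ y 0 := by
    rw [hy']
    exact analyticAt_const.mul (PainleveV.analyticAt_kummerKernel μ ν 0)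
  have hode : ∀ (f : ℂ → ℂ) (t : ℂ), PainleveV.SatisfiesODE v₁ (v₁ - μ) v₃ f t ↔
      t * deriv (deriv f) t + (μ + 1 + t) * deriv f t - ν * f t = 0 := by
    intro f t
    rw [PainleveV.SatisfiesODE, h13, h12', neg_mul, ← sub_eq_add_neg]
  have hyode : ∀ t : ℂ, t * deriv (deriv y) t + (μ + 1 + t) * deriv y t - ν * y t = 0 := by
    intro t
    have h1 : deriv y = fun t => Complex.Gamma (μ + 1) * Complex.Gamma (ν + 1) *
        deriv (PainleveV.kummerKernel μ ν) t := by
      funext s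
      rw [hy', deriv_const_mul_field]
    rw [h1, deriv_const_mul_field, hy']
    linear_combination (Complex.Gamma (μ + 1) * Complex.Gamma (ν + 1)) *
      PainleveV.kummerKernel_ode μ ν t
  refine ⟨⟨⟨hya, hy0, fun t => (hode y t).mpr (hyode t)⟩, fun f hf hfode => ?_⟩, ?_⟩
  · exact PainleveV.kummer_ode_unique hμ hya hy0 hf (Filter.Eventually.of_forall hyode)
      (hfode.mono fun t ht => (hode f t).mp ht)
  · intro U L hU hL hexp n t ht
    have h1 := PainleveV.exp_mul_tauVStar_eq h34 h13 hμ hν hμν (τ₁ := τ₁) (fun t => by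
      have := hτ₁ t
      rwa [hy, h13, h12', neg_neg] at this) hU hL hexp n ht
    exact ⟨h1, fun hre => by rw [PainleveV.tauVAverage_eq_tauV n t hre, h1]⟩
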